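/- Let $\Delta=\mathbb{R}$ or $\Delta=\mathbb{C}$, let $\beta>0$, and let $V:\Delta\to\mathbb{R}$ be continuous and such that \[\liminf_{|x|\to\infty}\big\{V(x)-\beta'\log|x|\big\}>-\infty\quad\text{for some }\beta'>1\text{ with }\beta'\ge\beta .\] Let $\mathcal{M}_1(\Delta)$ be the space of Borel probability measures on $\Delta$ with the weak topology, and put \[F_V(x,y)=\tfrac{\beta}{2}\log\tfrac{1}{|x-y|}+\tfrac12V(x)+\tfrac12V(y),\qquad I_V(\mu)=\iint F_V(x,y)\,d\mu(x)\,d\mu(y)\in(-\infty,+\infty],\] where $F_V=+\infty$ on the diagonal; $F_V$ is bounded from below, so that $I_V$ is well defined. For $N\ge1$ let \[Z_N=\int_{\Delta^N}\prod_{i<j}|x_i-x_j|^\beta\prod_{i=1}^N e^{-NV(x_i)}\,dx_1\cdots dx_N ,\] with $dx$ the Lebesgue measure on $\Delta$, and, when $Z_N<\infty$, let $\mathbb{P}_N$ be the probability measure on $\Delta^N$ with density $Z_N^{-1}\prod_{i<j}|x_i-x_j|^\beta\prod_{i}e^{-NV(x_i)}$, and $\mu^N=\frac1N\sum_{i=1}^N\delta_{x_i}$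 the empirical measure. Then: (a) $\{\mu\in\mathcal{M}_1(\Delta): I_V(\mu)\le\alpha\}$ is compact for every $\alpha\in\mathbb{R}$. (b) $I_V$ has a unique minimizer $\mu_V^*$ on $\mathcal{M}_1(\Delta)$, and $I_V(\mu_V^*)$ is finite. Both for $\Delta=\mathbb{R}$ and for $\Delta=\mathbb{C}$ there are $\beta$, $\beta'$, $V$ as above, with $Z_N<\infty$ for all $N$, for which the support of $\mu_V^*$ is not compact. If $\Delta=\mathbb{R}$, or if $\Delta=\mathbb{C}$ and $\beta'>2$, then $Z_N<\infty$ for all $N\ge1$; if $\Delta=\mathbb{C}$ and $\beta'>\beta$, then $Z_N<\infty$ for all large $N$. Whenever $Z_N<\infty$ for all large $N$ (thus always if $\Delta=\mathbb{R}$): (c) for every closed set $\mathcal{F}\subset\mathcal{M}_1(\Delta)$, \[\limsup_{N\to\infty}\frac1{N^2}\log\mathbb{P}_N(\mu^N\in\mathcal{F})\le-\inf_{\mu\in\mathcal{F}}\{I_V(\mu)-I_V(\mu_V^*)\};\] (d) for every open set $\mathcal{O}\subset\mathcal{M}_1(\Delta)$, \[\liminf_{N\to\infty}\frac1{N^2}\log\mathbb{P}_N(\mu^N\in\mathcal{O})\ge-\inf_{\mu\in\mathcal{O}}\{I_V(\mu)-I_V(\mu_V^*)\}.\]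 -/

import Mathlib

open MeasureTheory Filter Topology
open scoped ENNReal

noncomputable section

namespace CoulombGas

/-- The growth condition `liminf_{|x| → ∞} (V x - β' log |x|) > -∞`. -/
def WeakGrowth {Δ : Type} [NormedAddCommGroup Δ] (β' : ℝ) (V : Δ → ℝ) : Prop :=
  ⊥ < liminf (fun x : Δ => ((V x - β' * Real.log ‖x‖ : ℝ) : EReal)) (Bornology.cobounded Δ)

/-- The assumptions on the inverse temperature `β`, the exponent `β'` and the potential `V`. -/
structure Admissible {Δ : Type} [NormedAddCommGroup Δ] (β β' : ℝ) (V : Δ → ℝ) : Prop where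
  beta_pos : 0 < β
  one_lt : 1 < β'
  beta_le : β ≤ β'
  continuous : Continuous V
  growth : WeakGrowth β' V

/-- The kernel `F_V(x, y) = (β/2) log (1/|x - y|) + V(x)/2 + V(y)/2`, equal to `+∞` on the
diagonal when `β > 0`. -/
def kernel {Δ : Type} [NormedAddCommGroup Δ] (β : ℝ) (V : Δ → ℝ) (x y : Δ) : EReal :=
  ((β / 2 : ℝ) : EReal) * ENNReal.log (‖x - y‖ₑ⁻¹) + ((V x / 2 + V y / 2 : ℝ) : EReal)

/-- The integral of an extended real function, as the difference of the integrals of its positive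
and negative parts (meaningful when one of them is finite, e.g. when `f` is bounded below and `μ`
is finite). -/
def extIntegral {α : Type} [MeasurableSpace α] (μ : Measure α) (f : α → EReal) : EReal :=
  ((∫⁻ a, (f a).toENNReal ∂μ : ℝ≥0∞) : EReal) - ((∫⁻ a, (-f a).toENNReal ∂μ : ℝ≥0∞) : EReal)

/-- The weighted logarithmic energy `I_V(μ) = ∬ F_V(x, y) dμ(x) dμ(y)`. -/
def energy {Δ : Type} [NormedAddCommGroup Δ] [MeasurableSpace Δ] (β : ℝ) (V : Δ → ℝ)
    (μ : ProbabilityMeasure Δ) : EReal :=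
  extIntegral ((μ : Measure Δ).prod (μ : Measure Δ)) (fun p => kernel β V p.1 p.2)

/-- `μ` minimizes `I_V` over all Borel probability measures. -/
def IsMinimizer {Δ : Type} [NormedAddCommGroup Δ] [MeasurableSpace Δ] (β : ℝ) (V : Δ → ℝ)
    (μ : ProbabilityMeasure Δ) : Prop :=
  ∀ ν : ProbabilityMeasure Δ, energy β V μ ≤ energy β V ν

/-- The unnormalized density `∏_{i < j} |x_i - x_j|^β ∏_i exp (-N V(x_i))`. -/
def density {Δ : Type} [NormedAddCommGroup Δ] (β : ℝ) (V : Δ → ℝ) (N : ℕ) (x : Fin N → Δ) : ℝ :=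
  (∏ i : Fin N, ∏ j ∈ Finset.Ioi i, ‖x i - x j‖ ^ β) * ∏ i : Fin N, Real.exp (-(N * V (x i)))

/-- The normalization constant `Z_N ∈ [0, ∞]`. -/
def partitionFunction {Δ : Type} [NormedAddCommGroup Δ] [MeasureSpace Δ] (β : ℝ) (V : Δ → ℝ)
    (N : ℕ) : ℝ≥0∞ :=
  ∫⁻ x : Fin N → Δ, ENNReal.ofReal (density β V N x)

/-- The law of the gas of `N` particles: the measure with density `density / Z_N` with respect to
Lebesgue measure (a probability measure when `Z_N < ∞`). -/
def gasLaw {Δ : Type} [NormedAddCommGroup Δ] [MeasureSpace Δ] (β : ℝ) (V : Δ → ℝ) (N : ℕ) :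
    Measure (Fin N → Δ) :=
  (partitionFunction β V N)⁻¹ •
    (volume : Measure (Fin N → Δ)).withDensity (fun x => ENNReal.ofReal (density β V N x))

/-- The empirical measure `(1/N) ∑ δ_{x_i}`. -/
def empiricalMeasure {Δ : Type} [MeasurableSpace Δ] {N : ℕ} (x : Fin N → Δ) : Measure Δ :=
  (N : ℝ≥0∞)⁻¹ • ∑ i : Fin N, Measure.dirac (x i)

/-- The event that the empirical measure belongs to the set `A` of probability measures. -/
def empiricalEvent {Δ : Type} [MeasurableSpace Δ] (A : Set (ProbabilityMeasure Δ)) (N : ℕ) :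
    Set (Fin N → Δ) :=
  {x | ∃ μ ∈ A, (μ : Measure Δ) = empiricalMeasure x}

/-- The large deviation principle in speed `N²` with rate function `J`, for the weak topology, for
the empirical measures of configurations with laws `P N`: upper bound for closed sets and lower
bound for open sets. Here `log 0 = -∞` and `inf ∅ = +∞`. -/
def EmpiricalLDP {Δ : Type} [TopologicalSpace Δ] [MeasurableSpace Δ] [OpensMeasurableSpace Δ]
    (P : (N : ℕ) → Measure (Fin N → Δ)) (J : ProbabilityMeasure Δ → EReal) : Prop :=
  (∀ F : Set (ProbabilityMeasure Δ), IsClosed F →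
    limsup (fun N : ℕ => (((1 / (N : ℝ) ^ 2 : ℝ)) : EReal) *
      ENNReal.log (P N (empiricalEvent F N))) atTop ≤ -(⨅ μ ∈ F, J μ)) ∧
  (∀ O : Set (ProbabilityMeasure Δ), IsOpen O →
    -(⨅ μ ∈ O, J μ) ≤ liminf (fun N : ℕ => (((1 / (N : ℝ) ^ 2 : ℝ)) : EReal) *
      ENNReal.log (P N (empiricalEvent O N))) atTop)

end CoulombGas

end

/-! After adding a constant `C` with `β / 2 * log (1 + ‖x‖ ^ 2) ≤ V x + C`, the kernel is
nonnegative, and everything is done with integrals valued in `[0, ∞]`. Read through the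
stereographic projection, the shifted kernel is `β / 4 * (-log (1 - cosSq x y))` plus half of a
nonnegative potential at each point. Since `cosSq` is a scalar product of unit feature vectors, the
logarithmic series writes the kernel as a positive combination of separated products
(`posKernel_eq_tsum`, `cosSq_pow`). The energy is therefore positive definite, and strictly so
because the monomials in the features determine a probability measure (Stone–Weierstrass).
Uniqueness of the minimizer follows by a midpoint argument.

The shifted kernel blows up when both variables go to infinity, though not necessarily when only one
does. This already makes measures of bounded energy tight, hence compactness and existence. The same
argument along truncations shows that on a closed set where the energy exceeds `b`, one fixed
truncation of the kernel has energy exceeding `b` (`exists_forall_lt_truncEnergy`).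

For the upper bound, the density is tilted by the exponential of the truncated energy. Merging two
groups of particles only creates cross factors at most 1, so the tilted partition function is
submultiplicative in the number of particles. Once eventually finite, it grows at most
geometrically, which is invisible at speed `N ^ 2`, and the exponential Chebyshev inequality
concludes (`eventually_setLIntegral_density_le`). Finiteness of `Z_N` for large `N` is all that is
needed, even in the critical case `β' = β`.

For the lower bound, a measure of finite energy is approximated, with control of the energy, by a
compactly supported one with bounded density: conditioning on a ball, then mollifying. Positive
definiteness bounds the energy of the mollified measure. For such a measure, independent samples
satisfy the law of large numbers and, by Markov's inequality, an energy bound with probability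
bounded below. Passing to Lebesgue measure costs only a factor `c ^ N`. Both bounds applied to the
whole space give the asymptotics of `Z_N`, and quotients give the large deviation principle.

Noncompact support comes from the potential for which the gas is rotation invariant on the sphere:
its minimizer is unique, hence invariant under a reflection carrying a point of the support to
infinity. -/

noncomputable section

namespace CoulombGas

/-! ### The shifted kernel in stereographic form. -/

section Kernel

variable {Δ : Type} [NormedAddCommGroup Δ] {β : ℝ} {V : Δ → ℝ} {C : ℝ}

/-- The kernel, shifted by the constant `C` and viewed as a nonnegative function. -/
def posKernel (β : ℝ) (V : Δ → ℝ) (C : ℝ) (x y : Δ) : ℝ≥0∞ := (kernel β V x y + (C : EReal)).toENNReal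

/-- The square of the cosine of the spherical distance between the stereographic images. -/
def cosSq (x y : Δ) : ℝ := 1 - ‖x - y‖ ^ 2 / ((1 + ‖x‖ ^ 2) * (1 + ‖y‖ ^ 2))

/-- The potential relative to the stereographic projection. -/
def relPotential (β : ℝ) (V : Δ → ℝ) (C : ℝ) (x : Δ) : ℝ := V x + C - β / 2 * Real.log (1 + ‖x‖ ^ 2)

lemma kernel_of_ne {x y : Δ} (h : x ≠ y) :
    kernel β V x y = ((-(β / 2) * Real.log ‖x - y‖ + (V x / 2 + V y / 2) : ℝ) : EReal) := by
  have h0 : 0 < ‖x - y‖ := norm_pos_iff.2 (sub_ne_zero.2 h)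
  have : ENNReal.log (‖x - y‖ₑ⁻¹) = ((-Real.log ‖x - y‖ : ℝ) : EReal) := by
    rw [ENNReal.log_inv, ← ofReal_norm, ENNReal.log_ofReal_of_pos h0]
    simp
  rw [kernel, this, ← EReal.coe_mul, ← EReal.coe_add]
  congr 2
  ring

lemma kernel_self (hβ : 0 < β) (x : Δ) : kernel β V x x = ⊤ := by
  simp only [kernel, sub_self, enorm_zero, ENNReal.inv_zero, ENNReal.log_top]
  rw [EReal.coe_mul_top_of_pos (by positivity), EReal.top_add_coe]

lemma continuous_kernel (hV : Continuous V) :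
    Continuous fun p : Δ × Δ => kernel β V p.1 p.2 := by
  have h1 : Continuous fun p : Δ × Δ => ENNReal.log (‖p.1 - p.2‖ₑ⁻¹) :=
    ENNReal.continuous_log.comp (continuous_inv.comp (by fun_prop))
  have h2 : Continuous fun p : Δ × Δ => ((β / 2 : ℝ) : EReal) * ENNReal.log (‖p.1 - p.2‖ₑ⁻¹) := by
    refine continuous_iff_continuousAt.2 fun p => ?_
    refine EReal.Tendsto.const_mul h1.continuousAt ?_ ?_ <;> left
    · exact EReal.coe_ne_bot _
    · exact EReal.coe_ne_top _
  have h3 : Continuous fun p : Δ × Δ => ((V p.1 / 2 + V p.2 / 2 : ℝ) : EReal) :=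
    continuous_coe_real_ereal.comp (by fun_prop)
  refine continuous_iff_continuousAt.2 fun p => ?_
  exact (EReal.continuousAt_add (Or.inr (EReal.coe_ne_bot _)) (Or.inr (EReal.coe_ne_top _))).comp₂
    h2.continuousAt h3.continuousAt

lemma kernel_comm (x y : Δ) : kernel β V x y = kernel β V y x := by
  rw [kernel, kernel, add_comm (V x / 2), ← enorm_neg (x - y), neg_sub]

lemma posKernel_comm (x y : Δ) : posKernel β V C x y = posKernel β V C y x := by
  rw [posKernel, posKernel, kernel_comm]

lemma posKernel_self (hβ : 0 < β) (x : Δ) : posKernel β V C x x = ⊤ := by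
  simp [posKernel, kernel_self hβ]

lemma posKernel_of_ne {x y : Δ} (h : x ≠ y) :
    posKernel β V C x y =
      ENNReal.ofReal (-(β / 2) * Real.log ‖x - y‖ + (V x / 2 + V y / 2) + C) := by
  rw [posKernel, kernel_of_ne h, ← EReal.coe_add, EReal.toENNReal_of_ne_top (EReal.coe_ne_top _),
    EReal.toReal_coe]

lemma continuous_posKernel (hV : Continuous V) :
    Continuous fun p : Δ × Δ => posKernel β V C p.1 p.2 := by
  refine EReal.continuous_toENNReal.comp ?_
  refine continuous_iff_continuousAt.2 fun p => ?_
  exact (EReal.continuousAt_add (Or.inr (EReal.coe_ne_bot _)) (Or.inr (EReal.coe_ne_top _))).comp₂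
    (continuous_kernel hV).continuousAt continuousAt_const

/-- After the triangle inequality, the gap between the two sides is `(1 - ‖x‖ * ‖y‖) ^ 2`. -/
lemma norm_sub_sq_le (x y : Δ) : ‖x - y‖ ^ 2 ≤ (1 + ‖x‖ ^ 2) * (1 + ‖y‖ ^ 2) := by
  have h := norm_sub_le x y
  have h2 : ‖x - y‖ ^ 2 ≤ (‖x‖ + ‖y‖) ^ 2 := by gcongr
  nlinarith [sq_nonneg (1 - ‖x‖ * ‖y‖)]

lemma cosSq_nonneg (x y : Δ) : 0 ≤ cosSq x y := by
  rw [cosSq, sub_nonneg]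
  exact div_le_one_of_le₀ (norm_sub_sq_le x y) (by positivity)

lemma cosSq_le_one (x y : Δ) : cosSq x y ≤ 1 := by
  rw [cosSq, sub_le_self_iff]
  positivity

lemma cosSq_self (x : Δ) : cosSq x x = 1 := by simp [cosSq]

lemma cosSq_lt_one {x y : Δ} (h : x ≠ y) : cosSq x y < 1 := by
  have h0 : 0 < ‖x - y‖ := norm_pos_iff.2 (sub_ne_zero.2 h)
  rw [cosSq, sub_lt_self_iff]
  positivity

lemma log_one_sub_cosSq {x y : Δ} (h : x ≠ y) :
    Real.log (1 - cosSq x y) =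
      2 * Real.log ‖x - y‖ - Real.log (1 + ‖x‖ ^ 2) - Real.log (1 + ‖y‖ ^ 2) := by
  have h0 : 0 < ‖x - y‖ := norm_pos_iff.2 (sub_ne_zero.2 h)
  rw [cosSq, sub_sub_cancel, Real.log_div (by positivity) (by positivity),
    Real.log_mul (by positivity) (by positivity), Real.log_pow]
  push_cast
  ring

/-- The chordal distance on the sphere differs from `‖x - y‖` by one conformal factor per point, and
the logarithms of these factors are absorbed by the potential. -/
lemma kernel_real_eq {x y : Δ} (h : x ≠ y) :
    -(β / 2) * Real.log ‖x - y‖ + (V x / 2 + V y / 2) + C =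
      β / 4 * (-Real.log (1 - cosSq x y)) +
        relPotential β V C x / 2 + relPotential β V C y / 2 := by
  rw [log_one_sub_cosSq h, relPotential, relPotential]
  ring

/-- The logarithmic series with nonnegative terms, in the extended nonnegative reals. -/
lemma tsum_ofReal_pow_div {s : ℝ} (h0 : 0 ≤ s) (h1 : s < 1) :
    ∑' n : ℕ, ENNReal.ofReal (s ^ (n + 1) / (n + 1)) = ENNReal.ofReal (-Real.log (1 - s)) := by
  have h := Real.hasSum_pow_div_log_of_abs_lt_one (x := s) (by rwa [abs_of_nonneg h0])
  rw [← h.tsum_eq, ENNReal.ofReal_tsum_of_nonneg (fun n => by positivity) h.summable]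

/-- The value at `s = 1`, where `Real.log 0 = 0` makes the closed formula wrong; it lets the
expansion of the kernel hold on the diagonal as well. -/
lemma tsum_ofReal_one_div : ∑' n : ℕ, ENNReal.ofReal ((1 : ℝ) ^ (n + 1) / (n + 1)) = ⊤ := by
  by_contra hne
  have h : Summable fun n : ℕ => (1 : ℝ) ^ (n + 1) / (n + 1) := by
    have := ENNReal.summable_toReal hne
    refine this.congr fun n => ?_
    rw [ENNReal.toReal_ofReal (by positivity)]
  simp only [one_pow] at h
  have := (summable_nat_add_iff (f := fun n : ℕ => 1 / (n : ℝ)) 1).1 (by simpa using h)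
  exact Real.not_summable_one_div_natCast this

variable (hβ : 0 < β) (hC : ∀ x, β / 2 * Real.log (1 + ‖x‖ ^ 2) ≤ V x + C)

include hC in
lemma relPotential_nonneg (x : Δ) : 0 ≤ relPotential β V C x := sub_nonneg.2 (hC x)

include hβ hC

lemma kernel_real_nonneg {x y : Δ} (h : x ≠ y) :
    0 ≤ -(β / 2) * Real.log ‖x - y‖ + (V x / 2 + V y / 2) + C := by
  rw [kernel_real_eq h]
  have h1 := relPotential_nonneg hC x
  have h2 := relPotential_nonneg hC y
  have h3 : Real.log (1 - cosSq x y) ≤ 0 :=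
    Real.log_nonpos (by linarith [cosSq_le_one x y]) (by linarith [cosSq_nonneg x y])
  have : 0 ≤ β / 4 * (-Real.log (1 - cosSq x y)) := mul_nonneg (by positivity) (by linarith)
  linarith

lemma neg_le_kernel (x y : Δ) : ((-C : ℝ) : EReal) ≤ kernel β V x y := by
  rcases eq_or_ne x y with rfl | h
  · simp [kernel_self hβ]
  · rw [kernel_of_ne h]
    exact_mod_cast (by linarith [kernel_real_nonneg hβ hC h])

/-- The positive definite expansion of the kernel. -/
lemma posKernel_eq_tsum (x y : Δ) :
    posKernel β V C x y =
      ENNReal.ofReal (β / 4) * ∑' n : ℕ, ENNReal.ofReal (cosSq x y ^ (n + 1) / (n + 1)) +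
        (ENNReal.ofReal (relPotential β V C x / 2) +
          ENNReal.ofReal (relPotential β V C y / 2)) := by
  have h1 := relPotential_nonneg hC x
  have h2 := relPotential_nonneg hC y
  rcases eq_or_ne x y with rfl | h
  · rw [posKernel_self hβ, cosSq_self, tsum_ofReal_one_div, ENNReal.mul_top, top_add]
    simpa using hβ
  · have h3 : Real.log (1 - cosSq x y) ≤ 0 :=
      Real.log_nonpos (by linarith [cosSq_le_one x y]) (by linarith [cosSq_nonneg x y])
    rw [posKernel_of_ne h, kernel_real_eq h, tsum_ofReal_pow_div (cosSq_nonneg x y) (cosSq_lt_one h),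
      ← ENNReal.ofReal_mul (by positivity), ← ENNReal.ofReal_add (by positivity) (by positivity),
      ← ENNReal.ofReal_add (mul_nonneg (by positivity) (by linarith)) (by positivity), add_assoc]

/-- Outside the ball of radius `R` one has `1 / ‖x‖ + 1 / ‖y‖ < 2 / R`, so `‖x - y‖` is at most `2 /
R` times `‖x‖ * ‖y‖`, while the two potentials pay for `log ‖x‖ + log ‖y‖`. This is the only
confinement left when `β' = β`. -/
lemma le_posKernel_of_norm_gt {R : ℝ} (hR : 0 < R) {x y : Δ} (hx : R < ‖x‖) (hy : R < ‖y‖) :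
    ENNReal.ofReal (β / 2 * Real.log (R / 2)) ≤ posKernel β V C x y := by
  rcases eq_or_ne x y with rfl | h
  · simp [posKernel_self hβ]
  · have h0 : 0 < ‖x - y‖ := norm_pos_iff.2 (sub_ne_zero.2 h)
    rw [posKernel_of_ne h]
    refine ENNReal.ofReal_le_ofReal ?_
    have hx0 : 0 < ‖x‖ := hR.trans hx
    have hy0 : 0 < ‖y‖ := hR.trans hy
    have h1 : ‖x - y‖ * (R / 2) ≤ ‖x‖ * ‖y‖ := by
      have := norm_sub_le x y
      nlinarith
    have h2 := Real.log_le_log (by positivity) h1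
    rw [Real.log_mul (by positivity) (by positivity), Real.log_mul (by positivity) (by positivity)] at h2
    have h3 : ∀ z : Δ, 0 < ‖z‖ → β / 2 * Real.log ‖z‖ ≤ (V z + C) / 2 := by
      intro z hz
      have h4 : Real.log (‖z‖ ^ 2) ≤ Real.log (1 + ‖z‖ ^ 2) :=
        Real.log_le_log (by positivity) (by linarith)
      rw [Real.log_pow] at h4
      push_cast at h4
      have := hC z
      nlinarith
    have h5 := h3 x hx0
    have h6 := h3 y hy0
    have h7 := mul_le_mul_of_nonneg_left h2 (by positivity : 0 ≤ β / 2)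
    nlinarith

end Kernel

/-! ### The energy as an integral in `[0, ∞]`. -/

section Energy

/-- Where `f + c ≥ 0`, the identity `f⁺ + c⁺ = (f + c)⁺ + f⁻ + c⁻` holds pointwise and involves no
subtraction. After integration, the integral of `f⁻` can be cancelled because it is at most `c⁺`. -/
lemma extIntegral_eq_of_add_nonneg {α : Type} [MeasurableSpace α] (μ : Measure α)
    [IsProbabilityMeasure μ] {f : α → EReal} (hf : Measurable f) {c : ℝ}
    (hc : ∀ a, ((-c : ℝ) : EReal) ≤ f a) :
    extIntegral μ f = ((∫⁻ a, (f a + c).toENNReal ∂μ : ℝ≥0∞) : EReal) - c := by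
  have key : ∀ a, (f a).toENNReal + ENNReal.ofReal c =
      (f a + c).toENNReal + (-f a).toENNReal + ENNReal.ofReal (-c) := by
    intro a
    have h := hc a
    induction hfa : f a with
    | bot => simp [hfa] at h
    | top => simp
    | coe r =>
      rw [hfa] at h
      have h' : -c ≤ r := by exact_mod_cast h
      rw [← EReal.coe_add, ← EReal.coe_neg]
      simp only [EReal.toENNReal_of_ne_top (EReal.coe_ne_top _), EReal.toReal_coe]
      rcases le_total 0 r with hr | hr <;> rcases le_total 0 c with hc | hc
      · rw [ENNReal.ofReal_of_nonpos (p := -r) (by linarith),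
          ENNReal.ofReal_of_nonpos (p := -c) (by linarith), ENNReal.ofReal_add hr hc]; simp
      · rw [ENNReal.ofReal_of_nonpos (p := -r) (by linarith),
          ENNReal.ofReal_of_nonpos (p := c) (by linarith), add_zero, add_zero,
          ← ENNReal.ofReal_add (by linarith) (by linarith)]
        congr 1; ring
      · rw [ENNReal.ofReal_of_nonpos (p := r) (by linarith),
          ENNReal.ofReal_of_nonpos (p := -c) (by linarith), add_zero, zero_add,
          ← ENNReal.ofReal_add (by linarith) (by linarith)]
        congr 1; ring
      · have : r = 0 := by linarith
        have h2 : c = 0 := by linarith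
        simp [this, h2]
  have hneg : ∫⁻ a, (-f a).toENNReal ∂μ ≤ ENNReal.ofReal c := by
    calc ∫⁻ a, (-f a).toENNReal ∂μ ≤ ∫⁻ _, ENNReal.ofReal c ∂μ := by
          refine lintegral_mono fun a => ?_
          have : -f a ≤ (c : EReal) := by
            rw [EReal.neg_le]; simpa using hc a
          simpa [EReal.toENNReal_of_ne_top (EReal.coe_ne_top _)] using
            EReal.toENNReal_le_toENNReal this
      _ = _ := by simp
  have hm1 : Measurable fun a => (f a).toENNReal := hf.ereal_toENNReal
  have hm2 : Measurable fun a => (-f a).toENNReal := hf.neg.ereal_toENNReal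
  have hint : ∫⁻ a, (f a).toENNReal ∂μ + ENNReal.ofReal c =
      ∫⁻ a, (f a + c).toENNReal ∂μ + ∫⁻ a, (-f a).toENNReal ∂μ + ENNReal.ofReal (-c) := by
    have := lintegral_congr (μ := μ) key
    rw [lintegral_add_right _ measurable_const, lintegral_add_right _ measurable_const,
      lintegral_add_right _ hm2] at this
    simpa using this
  have hBtop : ∫⁻ a, (-f a).toENNReal ∂μ ≠ ⊤ := (hneg.trans_lt ENNReal.ofReal_lt_top).ne
  rw [extIntegral]
  generalize ∫⁻ a, (f a).toENNReal ∂μ = A at *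
  generalize ∫⁻ a, (-f a).toENNReal ∂μ = B at *
  generalize ∫⁻ a, (f a + c).toENNReal ∂μ = D at *
  lift B to NNReal using hBtop
  induction A with
  | top =>
    have : D = ⊤ := by
      by_contra hD
      rw [top_add] at hint
      exact absurd hint.symm (by simp [hD])
    subst this
    simp only [EReal.coe_ennreal_top]
    exact (EReal.top_sub_coe (B : ℝ)).trans (EReal.top_sub_coe c).symm
  | coe a =>
    have hD : D ≠ ⊤ := by
      rintro rfl
      simp at hint
    lift D to NNReal using hD
    have h := congrArg ENNReal.toReal hint
    rw [ENNReal.toReal_add (by simp) (by simp), ENNReal.toReal_add (by simp) (by simp),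
      ENNReal.toReal_add (by simp) (by simp)] at h
    simp only [ENNReal.coe_toReal, ENNReal.toReal_ofReal'] at h
    have h' : (a : ℝ) - B = D - c := by
      rcases le_total 0 c with hc | hc
      · rw [max_eq_left hc, max_eq_right (by linarith)] at h; linarith
      · rw [max_eq_right hc, max_eq_left (by linarith)] at h; linarith
    have e : ∀ z : NNReal, (((z : ℝ≥0∞)) : EReal) = ((z : ℝ) : EReal) := fun z => rfl
    rw [e, e, e, ← EReal.coe_sub, ← EReal.coe_sub, h']

variable {Δ : Type} [NormedAddCommGroup Δ] [MeasurableSpace Δ] {β : ℝ} {V : Δ → ℝ} {C : ℝ}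

/-- The mutual energy of two measures for the shifted kernel. -/
def mutualEnergy (β : ℝ) (V : Δ → ℝ) (C : ℝ) (μ ν : Measure Δ) : ℝ≥0∞ :=
  ∫⁻ x, ∫⁻ y, posKernel β V C x y ∂ν ∂μ

variable [BorelSpace Δ] [SecondCountableTopology Δ]

lemma measurable_posKernel (hV : Continuous V) :
    Measurable fun p : Δ × Δ => posKernel β V C p.1 p.2 :=
  (continuous_posKernel hV).measurable

lemma mutualEnergy_eq_lintegral_prod (hV : Continuous V) (μ ν : Measure Δ)
    [SFinite μ] [SFinite ν] :
    mutualEnergy β V C μ ν = ∫⁻ p, posKernel β V C p.1 p.2 ∂(μ.prod ν) :=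
  (lintegral_prod _ (measurable_posKernel hV).aemeasurable).symm

lemma energy_eq (hβ : 0 < β) (hV : Continuous V)
    (hC : ∀ x, β / 2 * Real.log (1 + ‖x‖ ^ 2) ≤ V x + C) (μ : ProbabilityMeasure Δ) :
    energy β V μ = (mutualEnergy β V C μ μ : EReal) - C := by
  rw [energy, extIntegral_eq_of_add_nonneg _ (continuous_kernel hV).measurable
    (fun p => neg_le_kernel hβ hC p.1 p.2), mutualEnergy_eq_lintegral_prod hV]
  rfl

end Energy

attribute [irreducible] posKernel

end CoulombGas

namespace CoulombGas

/-! ### Truncated energies, tightness and compactness. -/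

section Truncation

variable {Δ : Type} [NormedAddCommGroup Δ] [MeasurableSpace Δ]

/-- The energy of the kernel `Φ` truncated at level `n`. -/
def truncEnergy (Φ : Δ × Δ → ℝ≥0∞) (n : ℕ) (μ : Measure Δ) : ℝ≥0∞ :=
  ∫⁻ p, min (Φ p) n ∂(μ.prod μ)

/-- The kernel `Φ` blows up when both variables go to infinity. -/
def BlowsUpAtInfinity (Φ : Δ × Δ → ℝ≥0∞) : Prop :=
  ∀ M : ℕ, ∃ R : ℝ, ∀ x y : Δ, R < ‖x‖ → R < ‖y‖ → (M : ℝ≥0∞) ≤ Φ (x, y)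

omit [NormedAddCommGroup Δ] in
lemma truncEnergy_mono (Φ : Δ × Δ → ℝ≥0∞) (μ : Measure Δ) : Monotone fun n => truncEnergy Φ n μ :=
  fun _ _ h => lintegral_mono fun _ => min_le_min_left _ (by exact_mod_cast h)

omit [NormedAddCommGroup Δ] in
lemma truncEnergy_le (Φ : Δ × Δ → ℝ≥0∞) (n : ℕ) (μ : Measure Δ) :
    truncEnergy Φ n μ ≤ ∫⁻ p, Φ p ∂(μ.prod μ) :=
  lintegral_mono fun _ => min_le_left _ _

variable [BorelSpace Δ] [SecondCountableTopology Δ] {Φ : Δ × Δ → ℝ≥0∞}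

/-- The truncated kernel is bounded and continuous, and `μ ↦ μ ⊗ μ` is weakly continuous. The full
energy, a supremum of such functions, is only lower semicontinuous. -/
lemma continuous_truncEnergy (hΦ : Continuous Φ) (n : ℕ) :
    Continuous fun μ : ProbabilityMeasure Δ => truncEnergy Φ n (μ : Measure Δ) := by
  have hc : Continuous fun p => (min (Φ p) n).toNNReal := by
    refine ENNReal.continuousOn_toNNReal.comp_continuous (hΦ.min continuous_const) fun p => ?_
    exact ((min_le_right _ _).trans_lt (ENNReal.natCast_lt_top n)).ne
  have hn : ∀ p, (min (Φ p) n) ≤ n := fun p => min_le_right _ _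
  let f : BoundedContinuousFunction (Δ × Δ) NNReal :=
    BoundedContinuousFunction.mkOfBound ⟨_, hc⟩ n (by
      intro p q
      rw [NNReal.dist_eq, abs_le]
      have h : ∀ p, ((min (Φ p) n).toNNReal : ℝ) ≤ n := fun p => by
        have := ENNReal.toNNReal_mono (ENNReal.natCast_ne_top n) (hn p)
        exact_mod_cast this
      have hp := h p
      have hq := h q
      have hp0 : (0 : ℝ) ≤ (min (Φ p) n).toNNReal := NNReal.coe_nonneg _
      have hq0 : (0 : ℝ) ≤ (min (Φ q) n).toNNReal := NNReal.coe_nonneg _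
      simp only [ContinuousMap.coe_mk]
      constructor <;> linarith)
  have h1 := (ProbabilityMeasure.continuous_lintegral_boundedContinuousFunction f).comp
    ((ProbabilityMeasure.continuous_prod (α := Δ) (β := Δ)).comp
      (continuous_id.prodMk continuous_id))
  refine h1.congr fun μ => ?_
  simp only [Function.comp, truncEnergy, id, ProbabilityMeasure.toMeasure_prod]
  refine lintegral_congr fun p => ?_
  exact ENNReal.coe_toNNReal ((hn p).trans_lt (ENNReal.natCast_lt_top n)).ne

lemma iSup_truncEnergy (hΦ : Continuous Φ) (μ : Measure Δ) :
    ⨆ n, truncEnergy Φ n μ = ∫⁻ p, Φ p ∂(μ.prod μ) := by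
  simp only [truncEnergy]
  rw [← lintegral_iSup (fun n => hΦ.measurable.min measurable_const)
    (fun _ _ h p => min_le_min_left _ (by exact_mod_cast h))]
  refine lintegral_congr fun p => ?_
  refine le_antisymm (iSup_le fun n => min_le_left _ _) (le_of_forall_lt fun c hc => ?_)
  obtain ⟨n, hn⟩ := ENNReal.exists_nat_gt (hc.trans_le le_top).ne
  exact lt_iSup_iff.2 ⟨n, lt_min hc hn⟩

omit [SecondCountableTopology Δ] in
-- The product of the exterior of the ball with itself has mass the square of the exterior mass, and
-- the kernel is at least `M` there.
lemma mul_sq_le_truncEnergy {M n : ℕ} (hMn : M ≤ n) {R : ℝ}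
    (hR : ∀ x y : Δ, R < ‖x‖ → R < ‖y‖ → (M : ℝ≥0∞) ≤ Φ (x, y)) (μ : Measure Δ) [SFinite μ] :
    M * μ {x | R < ‖x‖} ^ 2 ≤ truncEnergy Φ n μ := by
  have hm : MeasurableSet {x : Δ | R < ‖x‖} := measurableSet_lt measurable_const measurable_norm
  calc M * μ {x | R < ‖x‖} ^ 2
      = ∫⁻ _ in {x : Δ | R < ‖x‖} ×ˢ {x : Δ | R < ‖x‖}, (M : ℝ≥0∞) ∂(μ.prod μ) := by
        rw [setLIntegral_const, Measure.prod_prod, sq]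
    _ ≤ ∫⁻ p in {x : Δ | R < ‖x‖} ×ˢ {x : Δ | R < ‖x‖}, min (Φ p) n ∂(μ.prod μ) := by
        refine setLIntegral_mono' (hm.prod hm) fun p hp => ?_
        exact le_min (hR p.1 p.2 hp.1 hp.2) (by exact_mod_cast hMn)
    _ ≤ _ := setLIntegral_le_lintegral _ _

variable [ProperSpace Δ]

/-- Sequences along which the truncated energies stay bounded are precompact. -/
lemma exists_tendsto_subseq_of_truncEnergy_le (hΦ : Continuous Φ) (hinf : BlowsUpAtInfinity Φ)
    {b : ℝ≥0∞} (hb : b ≠ ⊤) (μ : ℕ → ProbabilityMeasure Δ)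
    (hμ : ∀ n, truncEnergy Φ n (μ n : Measure Δ) ≤ b) :
    ∃ ν : ProbabilityMeasure Δ, ∃ φ : ℕ → ℕ, StrictMono φ ∧ Tendsto (μ ∘ φ) atTop (𝓝 ν) ∧
      ∫⁻ p, Φ p ∂((ν : Measure Δ).prod (ν : Measure Δ)) ≤ b := by
  have htight : IsTightMeasureSet (Set.range fun n => (μ n : Measure Δ)) := by
    refine isTightMeasureSet_range_of_tendsto_limsup_measure_norm_gt ?_
    refine ENNReal.tendsto_nhds_zero.2 fun ε hε => ?_
    -- With `M * ε ^ 2 > b`, an exterior mass above `ε` would force a truncated energy above `b`.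
    obtain ⟨M, hM⟩ := ENNReal.exists_nat_mul_gt (a := ε ^ 2) (pow_ne_zero 2 hε.ne') hb
    obtain ⟨R, hR⟩ := hinf M
    filter_upwards [eventually_ge_atTop R] with r hr
    refine limsup_le_of_le (by isBoundedDefault) ?_
    filter_upwards [eventually_ge_atTop M] with n hn
    by_contra! hlt
    have h1 := (mul_sq_le_truncEnergy hn
      (fun x y hx hy => hR x y (hr.trans_lt hx) (hr.trans_lt hy)) (μ n : Measure Δ)).trans (hμ n)
    have h2 : (M : ℝ≥0∞) * ε ^ 2 ≤ M * (μ n : Measure Δ) {x | r < ‖x‖} ^ 2 := by gcongr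
    exact absurd (hM.trans_le (h2.trans h1)) (lt_irrefl _)
  have hcomp : IsCompact (closure (Set.range μ)) := by
    refine isCompact_closure_of_isTightMeasureSet ?_
    convert htight using 1
    ext m
    simp [Set.mem_range]
  obtain ⟨ν, -, φ, hφ, hlim⟩ := hcomp.tendsto_subseq fun n => subset_closure (Set.mem_range_self n)
  refine ⟨ν, φ, hφ, hlim, ?_⟩
  -- The level `n` of the bound on `μ n` moves with `n`. Each fixed level `m` is eventually below it
  -- and passes to the limit by continuity; then the supremum over `m` is taken.
  rw [← iSup_truncEnergy hΦ]
  refine iSup_le fun m => ?_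
  refine le_of_tendsto (((continuous_truncEnergy hΦ m).tendsto ν).comp hlim) ?_
  filter_upwards [eventually_ge_atTop m] with n hn
  exact (truncEnergy_mono Φ _ (hn.trans (hφ.id_le n))).trans (hμ _)

lemma isCompact_setOf_lintegral_le (hΦ : Continuous Φ) (hinf : BlowsUpAtInfinity Φ)
    {b : ℝ≥0∞} (hb : b ≠ ⊤) :
    IsCompact {μ : ProbabilityMeasure Δ |
      ∫⁻ p, Φ p ∂((μ : Measure Δ).prod (μ : Measure Δ)) ≤ b} := by
  let := TopologicalSpace.metrizableSpaceMetric (ProbabilityMeasure Δ)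
  refine isCompact_iff_isSeqCompact.2 fun μ hμ => ?_
  obtain ⟨ν, φ, hφ, hlim, hν⟩ := exists_tendsto_subseq_of_truncEnergy_le hΦ hinf hb μ
    fun n => (truncEnergy_le _ _ _).trans (hμ n)
  exact ⟨ν, hν, φ, hφ, hlim⟩

/-- Otherwise each level `n` has a measure in `F` with `n`-truncated energy at most `b`; these
accumulate at a point of `F` of full energy at most `b`. The bounded kernel obtained here can be
evaluated on empirical measures, whose full energy is infinite because of the diagonal. -/
lemma exists_forall_lt_truncEnergy (hΦ : Continuous Φ) (hinf : BlowsUpAtInfinity Φ)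
    {b : ℝ≥0∞} (hb : b ≠ ⊤) {F : Set (ProbabilityMeasure Δ)} (hF : IsClosed F)
    (h : ∀ μ ∈ F, b < ∫⁻ p, Φ p ∂((μ : Measure Δ).prod (μ : Measure Δ))) :
    ∃ n, ∀ μ ∈ F, b < truncEnergy Φ n (μ : Measure Δ) := by
  by_contra! hcon
  choose μ hμF hμ using hcon
  obtain ⟨ν, φ, -, hlim, hν⟩ := exists_tendsto_subseq_of_truncEnergy_le hΦ hinf hb μ hμ
  exact absurd (h ν (hF.mem_of_tendsto hlim (Eventually.of_forall fun n => hμF _))) hν.not_gt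

lemma exists_forall_lintegral_le (hΦ : Continuous Φ) (hinf : BlowsUpAtInfinity Φ)
    {μ₀ : ProbabilityMeasure Δ}
    (h₀ : ∫⁻ p, Φ p ∂((μ₀ : Measure Δ).prod (μ₀ : Measure Δ)) ≠ ⊤) :
    ∃ μ : ProbabilityMeasure Δ, ∀ ν : ProbabilityMeasure Δ,
      ∫⁻ p, Φ p ∂((μ : Measure Δ).prod (μ : Measure Δ)) ≤
        ∫⁻ p, Φ p ∂((ν : Measure Δ).prod (ν : Measure Δ)) := by
  have hlsc : LowerSemicontinuous fun μ : ProbabilityMeasure Δ =>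
      ∫⁻ p, Φ p ∂((μ : Measure Δ).prod (μ : Measure Δ)) := by
    simp only [← iSup_truncEnergy hΦ]
    exact lowerSemicontinuous_iSup fun n => (continuous_truncEnergy hΦ n).lowerSemicontinuous
  have hne : {ν : ProbabilityMeasure Δ | ∫⁻ p, Φ p ∂((ν : Measure Δ).prod (ν : Measure Δ)) ≤
      ∫⁻ p, Φ p ∂((μ₀ : Measure Δ).prod (μ₀ : Measure Δ))}.Nonempty := ⟨μ₀, by simp⟩
  obtain ⟨μ, hμ, hmin⟩ := (hlsc.lowerSemicontinuousOn _).exists_isMinOn hne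
    (isCompact_setOf_lintegral_le hΦ hinf h₀)
  refine ⟨μ, fun ν => ?_⟩
  by_cases hν : ν ∈ {ν : ProbabilityMeasure Δ |
      ∫⁻ p, Φ p ∂((ν : Measure Δ).prod (ν : Measure Δ)) ≤
        ∫⁻ p, Φ p ∂((μ₀ : Measure Δ).prod (μ₀ : Measure Δ))}
  · exact hmin hν
  · exact le_trans hμ (not_le.1 hν).le

end Truncation

lemma blowsUpAtInfinity_posKernel {Δ : Type} [NormedAddCommGroup Δ] {β : ℝ} {V : Δ → ℝ} {C : ℝ}
    (hβ : 0 < β) (hC : ∀ x, β / 2 * Real.log (1 + ‖x‖ ^ 2) ≤ V x + C) :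
    BlowsUpAtInfinity fun p : Δ × Δ => posKernel β V C p.1 p.2 := by
  intro M
  -- The radius solves `β / 2 * log (R / 2) = M`.
  refine ⟨2 * Real.exp (2 / β * M), fun x y hx hy => ?_⟩
  refine le_trans ?_ (le_posKernel_of_norm_gt hβ hC (by positivity) hx hy)
  rw [mul_div_cancel_left₀ _ (by norm_num : (2 : ℝ) ≠ 0), Real.log_exp, ← mul_assoc,
    div_mul_div_cancel₀ (by norm_num : (2 : ℝ) ≠ 0), div_self hβ.ne', one_mul]
  simp

end CoulombGas

namespace CoulombGas

/-! ### Strict positive definiteness and uniqueness of the minimizer. -/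

section PositiveDefinite

variable {Δ : Type} [NormedAddCommGroup Δ] [InnerProductSpace ℝ Δ] [FiniteDimensional ℝ Δ]

/-- The index set of the coordinates of the stereographic embedding. -/
abbrev FeatureIndex (Δ : Type) [NormedAddCommGroup Δ] [InnerProductSpace ℝ Δ] : Type :=
  Option (Option (Fin (Module.finrank ℝ Δ)))

/-- The coordinates of a unit vector `η x`, with `⟪η x, η y⟫ = cosSq x y`. -/
def feature : FeatureIndex Δ → Δ → ℝ
  | none, x => 1 / (1 + ‖x‖ ^ 2)
  | some none, x => ‖x‖ ^ 2 / (1 + ‖x‖ ^ 2)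
  | some (some i), x => √2 * inner ℝ (stdOrthonormalBasis ℝ Δ i) x / (1 + ‖x‖ ^ 2)

lemma continuous_feature (k : FeatureIndex Δ) : Continuous (feature k) := by
  have h : ∀ x : Δ, 1 + ‖x‖ ^ 2 ≠ 0 := fun x => by positivity
  rcases k with _ | _ | i
  · exact continuous_const.div (by fun_prop) h
  · exact Continuous.div (by fun_prop) (by fun_prop) h
  · exact Continuous.div (by fun_prop) (by fun_prop) h

/-- Both sides have numerator `1 + ‖x‖ ^ 2 * ‖y‖ ^ 2 + 2 * ⟪x, y⟫`, which is what remains of `(1 +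
‖x‖ ^ 2) * (1 + ‖y‖ ^ 2)` after subtracting `‖x - y‖ ^ 2`. -/
lemma sum_feature_mul (x y : Δ) : ∑ k, feature k x * feature k y = cosSq x y := by
  have h : ∑ i, inner ℝ (stdOrthonormalBasis ℝ Δ i) x * inner ℝ (stdOrthonormalBasis ℝ Δ i) y =
      inner ℝ x y := by
    rw [← (stdOrthonormalBasis ℝ Δ).sum_inner_mul_inner x y]
    exact Finset.sum_congr rfl fun i _ => by rw [real_inner_comm]
  have hx : 1 + ‖x‖ ^ 2 ≠ 0 := by positivity
  have hy : 1 + ‖y‖ ^ 2 ≠ 0 := by positivity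
  have h2 : √2 * √2 = 2 := Real.mul_self_sqrt (by norm_num)
  rw [Fintype.sum_option, Fintype.sum_option]
  simp only [feature]
  have h3 : ∑ i, √2 * inner ℝ (stdOrthonormalBasis ℝ Δ i) x / (1 + ‖x‖ ^ 2) *
      (√2 * inner ℝ (stdOrthonormalBasis ℝ Δ i) y / (1 + ‖y‖ ^ 2)) =
      2 * inner ℝ x y / ((1 + ‖x‖ ^ 2) * (1 + ‖y‖ ^ 2)) := by
    rw [← h, Finset.mul_sum, Finset.sum_div]
    refine Finset.sum_congr rfl fun i _ => ?_
    rw [div_mul_div_comm, mul_mul_mul_comm, h2]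
  rw [h3, cosSq, norm_sub_sq_real]
  field_simp
  ring

lemma abs_feature_le_one (k : FeatureIndex Δ) (x : Δ) : |feature k x| ≤ 1 := by
  rw [← sq_le_one_iff_abs_le_one, sq]
  refine le_trans ?_ (sum_feature_mul x x ▸ cosSq_le_one x x)
  exact Finset.single_le_sum (f := fun k => feature k x * feature k x)
    (fun i _ => mul_self_nonneg _) (Finset.mem_univ k)

lemma eq_of_feature_eq {x y : Δ} (h : ∀ k, feature k x = feature k y) : x = y := by
  by_contra hne
  have h1 := cosSq_lt_one hne
  rw [← sum_feature_mul] at h1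
  simp only [h, sum_feature_mul, cosSq_self] at h1
  exact lt_irrefl _ h1

/-- The coordinates of the stereographic embedding as bounded continuous functions. -/
def boundedFeature (k : FeatureIndex Δ) : BoundedContinuousFunction Δ ℝ :=
  BoundedContinuousFunction.ofNormedAddCommGroup (feature k) (continuous_feature k) 1
    (abs_feature_le_one k)

lemma prod_boundedFeature_apply {n : ℕ} (f : Fin n → FeatureIndex Δ) (x : Δ) :
    (∏ k, boundedFeature (f k)) x = ∏ k, feature (f k) x := by
  rw [BoundedContinuousFunction.coe_prod, Finset.prod_apply]
  rfl

/-- Expanding a power of a scalar product separates the variables: every power is again a scalar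
product, of monomials in the features. -/
lemma cosSq_pow (n : ℕ) (x y : Δ) :
    cosSq x y ^ n = ∑ f : Fin n → FeatureIndex Δ,
      (∏ k, boundedFeature (f k)) x * (∏ k, boundedFeature (f k)) y := by
  rw [← sum_feature_mul, Fintype.sum_pow]
  refine Finset.sum_congr rfl fun f _ => ?_
  rw [Finset.prod_mul_distrib, prod_boundedFeature_apply, prod_boundedFeature_apply]

variable [MeasurableSpace Δ] [BorelSpace Δ]

/-- The moments of the stereographic image of a measure. -/
def moment {n : ℕ} (f : Fin n → FeatureIndex Δ) (μ : Measure Δ) : ℝ :=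
  ∫ x, (∏ k, boundedFeature (f k)) x ∂μ

/-- Probability measures are determined by the moments of their stereographic images. -/
lemma eq_of_moment_eq (μ ν : Measure Δ) [IsProbabilityMeasure μ] [IsProbabilityMeasure ν]
    (h : ∀ n, ∀ f : Fin (n + 1) → FeatureIndex Δ, moment f μ = moment f ν) : μ = ν := by
  -- The logarithmic series has no constant term; the missing moment of degree zero is the total
  -- mass.
  have h' : ∀ n, ∀ f : Fin n → FeatureIndex Δ, moment f μ = moment f ν := by
    intro n f
    cases n with
    | zero => simp [moment]
    | succ n => exact h n f
  let S : Set (BoundedContinuousFunction Δ ℝ) := Set.range boundedFeature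
  -- The algebra generated by the features separates points, so it determines the measure. It is
  -- spanned by monomials in the features, whose integrals are the moments.
  refine ext_of_forall_mem_subalgebra_integral_eq_of_polish (𝕜 := ℝ)
    (A := StarAlgebra.adjoin ℝ S) ?_ fun g hg => ?_
  · intro x y hxy
    obtain ⟨k, hk⟩ := not_forall.1 (mt eq_of_feature_eq hxy)
    refine ⟨feature k, ⟨⟨feature k, continuous_feature k⟩, ⟨boundedFeature k,
      StarAlgebra.subset_adjoin ℝ S ⟨k, rfl⟩, rfl⟩, rfl⟩, hk⟩
  · have hstar : star S = S := by
      have : ∀ g : BoundedContinuousFunction Δ ℝ, star g = g := fun g => by ext x; simp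
      ext g
      rw [Set.mem_star, this]
    have hg' : g ∈ Submodule.span ℝ (Submonoid.closure S : Set (BoundedContinuousFunction Δ ℝ)) := by
      have := StarAlgebra.adjoin_eq_span (R := ℝ) S
      rw [hstar, Set.union_self] at this
      rw [← this]
      exact hg
    clear hg
    induction hg' using Submodule.span_induction with
    | mem g hg =>
      have : ∃ n, ∃ f : Fin n → FeatureIndex Δ, g = ∏ k, boundedFeature (f k) := by
        induction hg using Submonoid.closure_induction with
        | mem g hg =>
          obtain ⟨k, rfl⟩ := hg
          exact ⟨1, fun _ => k, by simp⟩
        | one => exact ⟨0, Fin.elim0, by simp⟩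
        | mul g₁ g₂ _ _ h₁ h₂ =>
          obtain ⟨n₁, f₁, rfl⟩ := h₁
          obtain ⟨n₂, f₂, rfl⟩ := h₂
          refine ⟨n₁ + n₂, Fin.append f₁ f₂, ?_⟩
          rw [Fin.prod_univ_add]
          simp
      obtain ⟨n, f, rfl⟩ := this
      exact h' n f
    | zero => simp
    | add g₁ g₂ _ _ h₁ h₂ =>
      simp only [BoundedContinuousFunction.coe_add, Pi.add_apply]
      rw [integral_add (g₁.integrable μ) (g₂.integrable μ),
        integral_add (g₁.integrable ν) (g₂.integrable ν)]
      rw [h₁, h₂]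
    | smul c g _ h₁ =>
      simp only [BoundedContinuousFunction.coe_smul, smul_eq_mul, integral_const_mul]
      rw [h₁]

/-- The pairing of two measures by the `n`-th term of the expansion of the kernel. -/
def momentPairing (n : ℕ) (μ ν : Measure Δ) : ℝ≥0∞ :=
  ENNReal.ofReal ((∑ f : Fin (n + 1) → FeatureIndex Δ, moment f μ * moment f ν) / (n + 1))

variable {β : ℝ} {V : Δ → ℝ} {C : ℝ}

lemma lintegral_lintegral_cosSq_pow (n : ℕ) (μ ν : Measure Δ) [IsProbabilityMeasure μ]
    [IsProbabilityMeasure ν] :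
    ∫⁻ x, ∫⁻ y, ENNReal.ofReal (cosSq x y ^ (n + 1) / (n + 1)) ∂ν ∂μ =
      momentPairing n μ ν := by
  have hn : (0 : ℝ) < n + 1 := by positivity
  simp only [momentPairing]
  have h1 : ∀ x, ∫⁻ y, ENNReal.ofReal (cosSq x y ^ (n + 1) / (n + 1)) ∂ν =
      ENNReal.ofReal ((∑ f : Fin (n + 1) → FeatureIndex Δ,
        (∏ k, boundedFeature (f k)) x * moment f ν) / (n + 1)) := by
    intro x
    rw [← ofReal_integral_eq_lintegral_ofReal, integral_div]
    · simp only [cosSq_pow]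
      rw [integral_finsetSum _ fun f _ =>
        ((∏ k, boundedFeature (f k)).integrable ν).const_mul _]
      simp only [integral_const_mul, moment]
    · simp only [cosSq_pow]
      exact (integrable_finsetSum _ fun f _ =>
        ((∏ k, boundedFeature (f k)).integrable ν).const_mul _).div_const _
    · exact Eventually.of_forall fun y => by have := cosSq_nonneg x y; positivity
  simp only [h1]
  have hint : Integrable (fun x => (∑ f : Fin (n + 1) → FeatureIndex Δ,
        (∏ k, boundedFeature (f k)) x * moment f ν) / (n + 1)) μ :=
    (integrable_finsetSum _ fun f _ =>
        ((∏ k, boundedFeature (f k)).integrable μ).mul_const _).div_const _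
  rw [← ofReal_integral_eq_lintegral_ofReal hint, integral_div]
  · rw [integral_finsetSum _ fun f _ => ((∏ k, boundedFeature (f k)).integrable μ).mul_const _]
    simp only [integral_mul_const, moment]
  · refine Eventually.of_forall fun x => ?_
    -- The sign of the inner integral is not visible on the moments; it is read off from `cosSq ≥
    -- 0`.
    have h2 : (∑ f : Fin (n + 1) → FeatureIndex Δ, (∏ k, boundedFeature (f k)) x * moment f ν) =
        ∫ y, cosSq x y ^ (n + 1) ∂ν := by
      simp only [cosSq_pow]
      rw [integral_finsetSum _ fun f _ =>
        ((∏ k, boundedFeature (f k)).integrable ν).const_mul _]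
      simp only [integral_const_mul, moment]
    simp only [Pi.zero_apply]
    rw [h2]
    exact div_nonneg (integral_nonneg fun y => pow_nonneg (cosSq_nonneg x y) _) hn.le

lemma measurable_cosSq : Measurable fun p : Δ × Δ => cosSq p.1 p.2 := by
  simp only [cosSq]
  fun_prop

omit [NormedAddCommGroup Δ] [InnerProductSpace ℝ Δ] [FiniteDimensional ℝ Δ] [BorelSpace Δ] in
lemma lintegral_lintegral_tsum_add {g : ℕ → Δ × Δ → ℝ≥0∞} (hg : ∀ n, Measurable (g n))
    {w : Δ → ℝ≥0∞} (hw : Measurable w) (c : ℝ≥0∞)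
    (μ ν : Measure Δ) [IsProbabilityMeasure μ] [IsProbabilityMeasure ν] :
    ∫⁻ x, ∫⁻ y, (c * ∑' n, g n (x, y) + (w x + w y)) ∂ν ∂μ =
      c * ∑' n, ∫⁻ x, ∫⁻ y, g n (x, y) ∂ν ∂μ + (∫⁻ x, w x ∂μ + ∫⁻ x, w x ∂ν) := by
  have hg1 : ∀ n, ∀ x, Measurable fun y : Δ => g n (x, y) := fun n x =>
    (hg n).comp measurable_prodMk_left
  have h1 : ∀ x, ∫⁻ y, (c * ∑' n, g n (x, y) + (w x + w y)) ∂ν =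
      c * ∑' n, ∫⁻ y, g n (x, y) ∂ν + (w x + ∫⁻ x, w x ∂ν) := by
    intro x
    simp_rw [← add_assoc]
    rw [lintegral_add_right _ hw, lintegral_add_right _ measurable_const,
      lintegral_const_mul _ (Measurable.tsum (hg1 · x)),
      lintegral_tsum fun n => (hg1 n x).aemeasurable]
    simp
  have h2 : ∀ n, Measurable fun x => ∫⁻ y, g n (x, y) ∂ν :=
    fun n => (hg n).lintegral_prod_right'
  simp only [h1]
  simp_rw [← add_assoc]
  rw [lintegral_add_right _ measurable_const, lintegral_add_right _ hw,
    lintegral_const_mul _ (Measurable.tsum h2),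
    lintegral_tsum fun n => (h2 n).aemeasurable]
  simp

/-- All terms of the expansion are nonnegative, so Tonelli's theorem applies even when the energy is
infinite. What remains is a bilinear form in the moments plus terms that are linear in each measure
separately. -/
lemma mutualEnergy_eq_tsum (hβ : 0 < β) (hV : Continuous V)
    (hC : ∀ x, β / 2 * Real.log (1 + ‖x‖ ^ 2) ≤ V x + C)
    (μ ν : Measure Δ) [IsProbabilityMeasure μ] [IsProbabilityMeasure ν] :
    mutualEnergy β V C μ ν = ENNReal.ofReal (β / 4) * ∑' n : ℕ, momentPairing n μ ν +
      (∫⁻ x, ENNReal.ofReal (relPotential β V C x / 2) ∂μ +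
        ∫⁻ x, ENNReal.ofReal (relPotential β V C x / 2) ∂ν) := by
  have hw : Measurable fun x => ENNReal.ofReal (relPotential β V C x / 2) := by
    have : Measurable V := hV.measurable
    simp only [relPotential]
    fun_prop
  have hs : ∀ n : ℕ, Measurable fun p : Δ × Δ =>
      ENNReal.ofReal (cosSq p.1 p.2 ^ (n + 1) / (n + 1)) := fun n =>
    ((measurable_cosSq.pow_const _).div_const _).ennreal_ofReal
  simp only [mutualEnergy, posKernel_eq_tsum hβ hC, ← lintegral_lintegral_cosSq_pow]
  exact lintegral_lintegral_tsum_add hs hw _ μ ν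

omit [BorelSpace Δ] in
-- The difference is a sum of squares of `moment f μ - moment f ν`.
lemma sum_moment_mul_le (n : ℕ) (μ ν : Measure Δ) :
    2 * momentPairing n μ ν ≤
      momentPairing n μ μ +
      momentPairing n ν ν := by
  have hn : (0 : ℝ) < n + 1 := by positivity
  simp only [momentPairing]
  have h : ∀ ρ : Measure Δ, 0 ≤ (∑ f : Fin (n + 1) → FeatureIndex Δ, moment f ρ * moment f ρ) /
      (n + 1) := fun ρ => div_nonneg (Finset.sum_nonneg fun f _ => mul_self_nonneg _) hn.le
  rw [← ENNReal.ofReal_add (h μ) (h ν), ← ENNReal.ofReal_ofNat 2, ← ENNReal.ofReal_mul (by norm_num),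
    ← add_div, ← mul_div_assoc, ← Finset.sum_add_distrib, Finset.mul_sum]
  refine ENNReal.ofReal_le_ofReal ?_
  gcongr with f
  nlinarith [sq_nonneg (moment f μ - moment f ν)]

omit [BorelSpace Δ] in
lemma eq_of_sum_moment_mul_ge (n : ℕ) (μ ν : Measure Δ)
    (h : momentPairing n μ μ +
      momentPairing n ν ν ≤
      2 * momentPairing n μ ν)
    (f : Fin (n + 1) → FeatureIndex Δ) : moment f μ = moment f ν := by
  have hn : (0 : ℝ) < n + 1 := by positivity
  simp only [momentPairing] at h
  have h0 : ∀ ρ : Measure Δ, 0 ≤ (∑ f : Fin (n + 1) → FeatureIndex Δ, moment f ρ * moment f ρ) /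
      (n + 1) := fun ρ => div_nonneg (Finset.sum_nonneg fun f _ => mul_self_nonneg _) hn.le
  rw [← ENNReal.ofReal_add (h0 μ) (h0 ν), ← ENNReal.ofReal_ofNat 2,
    ← ENNReal.ofReal_mul (by norm_num), ← add_div, ← mul_div_assoc, ← Finset.sum_add_distrib,
    Finset.mul_sum] at h
  set A := ∑ f : Fin (n + 1) → FeatureIndex Δ, (moment f μ * moment f μ + moment f ν * moment f ν)
  set B := ∑ f : Fin (n + 1) → FeatureIndex Δ, 2 * (moment f μ * moment f ν)
  have hAB : A ≤ B := by
    rcases le_or_gt 0 B with hB | hB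
    · have := (ENNReal.ofReal_le_ofReal_iff (div_nonneg hB hn.le)).1 h
      exact (div_le_div_iff_of_pos_right hn).1 this
    -- `ENNReal.ofReal` cuts a negative `B` to zero, so this case needs its own argument: then `A ≤
    -- 0`, while `A + B` is a sum of squares.
    · rw [ENNReal.ofReal_of_nonpos (p := B / (n + 1)) (div_nonpos_of_nonpos_of_nonneg hB.le hn.le)] at h
      have h1 : A / (n + 1) ≤ 0 := ENNReal.ofReal_eq_zero.1 (le_antisymm h bot_le)
      have h2 : A ≤ 0 := by
        by_contra! hA
        exact absurd h1 (not_le.2 (by positivity))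
      have h3 : ∑ f : Fin (n + 1) → FeatureIndex Δ, (moment f μ + moment f ν) ^ 2 = A + B := by
        rw [← Finset.sum_add_distrib]
        exact Finset.sum_congr rfl fun f _ => by ring
      have h4 : 0 ≤ A + B := h3 ▸ Finset.sum_nonneg fun f _ => sq_nonneg _
      linarith
  have hsum : ∑ f : Fin (n + 1) → FeatureIndex Δ, (moment f μ - moment f ν) ^ 2 ≤ 0 := by
    have : ∑ f : Fin (n + 1) → FeatureIndex Δ, (moment f μ - moment f ν) ^ 2 = A - B := by
      rw [← Finset.sum_sub_distrib]
      exact Finset.sum_congr rfl fun f _ => by ring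
    linarith
  have h1 := (Finset.sum_eq_zero_iff_of_nonneg (fun f _ => sq_nonneg (moment f μ - moment f ν))).1
    (le_antisymm hsum (Finset.sum_nonneg fun f _ => sq_nonneg _)) f (Finset.mem_univ f)
  exact sub_eq_zero.1 (pow_eq_zero_iff two_ne_zero |>.1 h1)

section Comparison

variable (hβ : 0 < β) (hV : Continuous V) (hC : ∀ x, β / 2 * Real.log (1 + ‖x‖ ^ 2) ≤ V x + C)
  (μ ν : Measure Δ) [IsProbabilityMeasure μ] [IsProbabilityMeasure ν]
include hβ hV hC

/-- The energy is positive definite. -/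
lemma two_mul_mutualEnergy_le :
    2 * mutualEnergy β V C μ ν ≤ mutualEnergy β V C μ μ + mutualEnergy β V C ν ν := by
  rw [mutualEnergy_eq_tsum hβ hV hC, mutualEnergy_eq_tsum hβ hV hC, mutualEnergy_eq_tsum hβ hV hC]
  have h := ENNReal.tsum_le_tsum fun n => sum_moment_mul_le n μ ν
  rw [ENNReal.tsum_mul_left, ENNReal.tsum_add] at h
  generalize ∫⁻ x, ENNReal.ofReal (relPotential β V C x / 2) ∂μ = a
  generalize ∫⁻ x, ENNReal.ofReal (relPotential β V C x / 2) ∂ν = b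
  calc _ = ENNReal.ofReal (β / 4) * (2 * ∑' n : ℕ, momentPairing n μ ν) +
          (a + a + (b + b)) := by ring
    _ ≤ _ := add_le_add_left (mul_le_mul_right h _) _
    _ = _ := by ring

/-- The energy is strictly positive definite. -/
lemma eq_of_mutualEnergy_add_le (hμ : mutualEnergy β V C μ μ ≠ ⊤) (hν : mutualEnergy β V C ν ν ≠ ⊤)
    (h : mutualEnergy β V C μ μ + mutualEnergy β V C ν ν ≤ 2 * mutualEnergy β V C μ ν) : μ = ν := by
  refine eq_of_moment_eq μ ν fun n f => eq_of_sum_moment_mul_ge n μ ν ?_ f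
  -- A strict inequality in a single degree survives summation because the energies are finite, and
  -- contradicts `h`.
  by_contra! hlt
  rw [mutualEnergy_eq_tsum hβ hV hC] at hμ hν
  rw [mutualEnergy_eq_tsum hβ hV hC, mutualEnergy_eq_tsum hβ hV hC,
    mutualEnergy_eq_tsum hβ hV hC] at h
  have hβ' : ENNReal.ofReal (β / 4) ≠ 0 := by simpa using hβ
  have ha : ∫⁻ x, ENNReal.ofReal (relPotential β V C x / 2) ∂μ ≠ ⊤ := by
    intro ha; simp [ha] at hμ
  have hb : ∫⁻ x, ENNReal.ofReal (relPotential β V C x / 2) ∂ν ≠ ⊤ := by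
    intro hb; simp [hb] at hν
  have hA : ∑' n : ℕ, momentPairing n μ μ ≠ ⊤ := by
    intro hA; simp [hA, ENNReal.mul_top hβ'] at hμ
  have hB : ∑' n : ℕ, momentPairing n ν ν ≠ ⊤ := by
    intro hB; simp [hB, ENNReal.mul_top hβ'] at hν
  have hle := ENNReal.tsum_le_tsum fun n => sum_moment_mul_le n μ ν
  have hlt' := ENNReal.tsum_lt_tsum
    (ne_top_of_le_ne_top (by rw [ENNReal.tsum_add]; exact ENNReal.add_ne_top.2 ⟨hA, hB⟩) hle)
    (fun n => sum_moment_mul_le n μ ν) hlt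
  rw [ENNReal.tsum_mul_left, ENNReal.tsum_add] at hlt'
  generalize ∫⁻ x, ENNReal.ofReal (relPotential β V C x / 2) ∂μ = a at *
  generalize ∫⁻ x, ENNReal.ofReal (relPotential β V C x / 2) ∂ν = b at *
  have h3 := ENNReal.add_lt_add_right (a := a + a + (b + b)) (by simp [ha, hb])
    (ENNReal.mul_lt_mul_right hβ' ENNReal.ofReal_ne_top hlt')
  refine absurd h3 (not_lt.2 ?_)
  calc _ = _ := by ring
    _ ≤ _ := h
    _ = _ := by ring

end Comparison

omit [InnerProductSpace ℝ Δ] [FiniteDimensional ℝ Δ] in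
lemma mutualEnergy_comm [SecondCountableTopology Δ] (hV : Continuous V) (μ ν : Measure Δ)
    [SFinite μ] [SFinite ν] : mutualEnergy β V C μ ν = mutualEnergy β V C ν μ := by
  rw [mutualEnergy, lintegral_lintegral_swap (measurable_posKernel hV).aemeasurable]
  simp only [mutualEnergy, posKernel_comm]

/-- A probability measure of minimal finite energy is unique. -/
lemma eq_of_forall_mutualEnergy_le (hβ : 0 < β) (hV : Continuous V)
    (hC : ∀ x, β / 2 * Real.log (1 + ‖x‖ ^ 2) ≤ V x + C) {μ ν : ProbabilityMeasure Δ}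
    (hfin : mutualEnergy β V C (μ : Measure Δ) μ ≠ ⊤)
    (hμ : ∀ ρ : ProbabilityMeasure Δ,
      mutualEnergy β V C (μ : Measure Δ) μ ≤ mutualEnergy β V C (ρ : Measure Δ) ρ)
    (hν : ∀ ρ : ProbabilityMeasure Δ,
      mutualEnergy β V C (ν : Measure Δ) ν ≤ mutualEnergy β V C (ρ : Measure Δ) ρ) : μ = ν := by
  have heq : mutualEnergy β V C (ν : Measure Δ) ν = mutualEnergy β V C (μ : Measure Δ) μ :=
    le_antisymm (hν μ) (hμ ν)
  have hm := measurable_posKernel (β := β) (C := C) hV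
  have hsymm : mutualEnergy β V C (ν : Measure Δ) μ = mutualEnergy β V C (μ : Measure Δ) ν :=
    mutualEnergy_comm hV _ _
  -- Comparing the energy of the midpoint with the minimum `a` gives `4 * a ≤ 2 * a + 2 * b`, where
  -- `b` is the mutual energy. This is the equality case of positive definiteness.
  let ρ : Measure Δ := (2⁻¹ : ℝ≥0∞) • ((μ : Measure Δ) + ν)
  have hρ : IsProbabilityMeasure ρ := ⟨by
    simp only [ρ, Measure.smul_apply, Measure.add_apply, measure_univ, smul_eq_mul]
    rw [one_add_one_eq_two, ENNReal.inv_mul_cancel (by simp) (by simp)]⟩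
  have h1 : mutualEnergy β V C ρ ρ = 4⁻¹ * (mutualEnergy β V C (μ : Measure Δ) μ +
      mutualEnergy β V C (ν : Measure Δ) ν + 2 * mutualEnergy β V C (μ : Measure Δ) ν) := by
    have hm' : ∀ κ : ProbabilityMeasure Δ,
        Measurable fun x => ∫⁻ y, posKernel β V C x y ∂(κ : Measure Δ) := fun κ =>
      hm.lintegral_prod_right'
    have h4 : (4 : ℝ≥0∞)⁻¹ = 2⁻¹ * 2⁻¹ := by
      rw [← ENNReal.mul_inv (by simp) (by simp)]
      norm_num
    have h2 : mutualEnergy β V C ρ ρ = 2⁻¹ * (2⁻¹ *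
        (mutualEnergy β V C (μ : Measure Δ) μ + mutualEnergy β V C (μ : Measure Δ) ν +
          (mutualEnergy β V C (ν : Measure Δ) μ + mutualEnergy β V C (ν : Measure Δ) ν))) := by
      simp only [mutualEnergy, ρ, lintegral_smul_measure, lintegral_add_measure, smul_eq_mul]
      rw [lintegral_const_mul' _ _ (by simp), lintegral_const_mul' _ _ (by simp),
        lintegral_add_left (hm' μ), lintegral_add_left (hm' μ), ← mul_add]
    rw [h2, hsymm, h4]
    ring
  have h3 := hμ ⟨ρ, hρ⟩
  simp only [ProbabilityMeasure.coe_mk, h1, heq] at h3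
  refine Subtype.ext (eq_of_mutualEnergy_add_le hβ hV hC (μ : Measure Δ) (ν : Measure Δ) hfin
    (heq ▸ hfin) ?_)
  rw [heq]
  generalize mutualEnergy β V C (μ : Measure Δ) μ = a at *
  generalize mutualEnergy β V C (μ : Measure Δ) ν = b at *
  have h5 := mul_le_mul_right h3 4
  rw [← mul_assoc, ENNReal.mul_inv_cancel (by simp) (by simp), one_mul,
    show (4 : ℝ≥0∞) * a = (a + a) + (a + a) by ring] at h5
  exact (ENNReal.add_le_add_iff_left (by simp [hfin])).1 h5

end PositiveDefinite

end CoulombGas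

namespace CoulombGas

/-! ### Splitting the gas into two groups of particles. -/

section Density

variable {Δ : Type} [NormedAddCommGroup Δ] {β : ℝ} {V : Δ → ℝ}

lemma prod_Ioi_eq {n : ℕ} (f : Fin n → Fin n → ℝ) :
    ∏ i, ∏ j ∈ Finset.Ioi i, f i j = ∏ i, ∏ j, if i < j then f i j else 1 := by
  refine Finset.prod_congr rfl fun i _ => ?_
  rw [← Finset.prod_filter]
  congr 1
  ext j
  simp

lemma density_nonneg (N : ℕ) (x : Fin N → Δ) : 0 ≤ density β V N x := by
  unfold density
  positivity

/-- The density of the union of two groups of particles. -/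
lemma density_append {n m : ℕ} (x : Fin n → Δ) (y : Fin m → Δ) :
    density β V (n + m) (Fin.append x y) = density β V n x * density β V m y *
      ∏ i, ∏ j, (‖x i - y j‖ ^ β * Real.exp (-(V (x i) + V (y j)))) := by
  have h1 : ∀ (k : ℕ) (z : Fin k → Δ), density β V k z =
      (∏ i, ∏ j, if i < j then ‖z i - z j‖ ^ β else 1) * ∏ i, Real.exp (-(k * V (z i))) :=
    fun k z => by rw [density, prod_Ioi_eq]
  have h2 : ∀ (i : Fin n) (j : Fin m), Fin.castAdd m i < Fin.natAdd n j := fun i j => by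
    rw [Fin.lt_def]
    simp only [Fin.val_castAdd, Fin.val_natAdd]
    omega
  simp only [h1, Fin.prod_univ_add, Fin.append_left, Fin.append_right, h2, (h2 _ _).not_gt,
    if_true, if_false, Finset.prod_const_one, Finset.prod_mul_distrib]
  have h3 : ∀ i j : Fin n, Fin.castAdd m i < Fin.castAdd m j ↔ i < j := fun i j => Iff.rfl
  have h4 : ∀ i j : Fin m, Fin.natAdd n i < Fin.natAdd n j ↔ i < j := fun i j => by
    rw [Fin.lt_def, Fin.lt_def, Fin.val_natAdd, Fin.val_natAdd, Nat.add_lt_add_iff_left]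
  simp only [h3, h4]
  -- Of the `n + m` copies of `V (x i)`, `n` belong to the density of the first group and `m` are
  -- distributed over the cross pairs.
  have h5 : ∏ i : Fin n, Real.exp (-(((n + m : ℕ) : ℝ) * V (x i))) =
      (∏ i : Fin n, Real.exp (-(n * V (x i)))) * ∏ i : Fin n, Real.exp (-(m * V (x i))) := by
    rw [← Finset.prod_mul_distrib]
    refine Finset.prod_congr rfl fun i _ => ?_
    rw [← Real.exp_add]
    push_cast
    congr 1
    ring
  have h6 : ∏ i : Fin m, Real.exp (-(((n + m : ℕ) : ℝ) * V (y i))) =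
      (∏ i : Fin m, Real.exp (-(m * V (y i)))) * ∏ i : Fin m, Real.exp (-(n * V (y i))) := by
    rw [← Finset.prod_mul_distrib]
    refine Finset.prod_congr rfl fun i _ => ?_
    rw [← Real.exp_add]
    push_cast
    congr 1
    ring
  have h7 : ∏ i : Fin n, ∏ j : Fin m, Real.exp (-(V (x i) + V (y j))) =
      (∏ i : Fin n, Real.exp (-(m * V (x i)))) * ∏ i : Fin m, Real.exp (-(n * V (y i))) := by
    simp only [← Real.exp_sum]
    rw [← Real.exp_add]
    congr 1
    simp only [neg_add, Finset.sum_add_distrib, Finset.sum_const, Finset.card_univ,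
      Fintype.card_fin, nsmul_eq_mul, ← Finset.mul_sum, Finset.sum_neg_distrib]
    ring
  rw [h5, h6, h7]
  ring

variable [MeasurableSpace Δ] [BorelSpace Δ] [SecondCountableTopology Δ]

lemma measurable_density (hV : Continuous V) (N : ℕ) : Measurable (density β V N) := by
  have := hV.measurable
  refine Measurable.mul ?_ ?_
  · refine Finset.measurable_fun_prod _ fun i _ => Finset.measurable_fun_prod _ fun j _ => ?_
    have : Measurable fun x : Fin N → Δ => ‖x i - x j‖ := by fun_prop
    exact this.pow_const β
  · exact Finset.measurable_fun_prod _ fun i _ => by fun_prop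

end Density

section Append

variable {Δ : Type} [MeasureSpace Δ] [SigmaFinite (volume : Measure Δ)]

lemma measurePreserving_append (n m : ℕ) :
    MeasurePreserving (fun p : (Fin n → Δ) × (Fin m → Δ) => Fin.append p.1 p.2)
      (volume.prod volume) volume := by
  have h := (volume_measurePreserving_piCongrLeft (fun _ : Fin (n + m) => Δ)
    (finSumFinEquiv (m := n) (n := m))).comp
    (volume_measurePreserving_sumPiEquivProdPi_symm (fun _ : Fin n ⊕ Fin m => Δ))
  have heq : (fun p : (Fin n → Δ) × (Fin m → Δ) => Fin.append p.1 p.2) =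
      (MeasurableEquiv.piCongrLeft (fun _ : Fin (n + m) => Δ) finSumFinEquiv) ∘
        (MeasurableEquiv.sumPiEquivProdPi fun _ : Fin n ⊕ Fin m => Δ).symm := by
    funext p i
    rw [Function.comp_apply]
    refine Fin.addCases (fun i => ?_) (fun i => ?_) i
    · rw [Fin.append_left, ← finSumFinEquiv_apply_left, MeasurableEquiv.piCongrLeft_apply_apply]
      rfl
    · rw [Fin.append_right, ← finSumFinEquiv_apply_right, MeasurableEquiv.piCongrLeft_apply_apply]
      rfl
  rw [heq]
  exact h

end Append

/-! ### Submultiplicativity of tilted partition functions. -/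

section Submultiplicative

variable {Δ : Type} [NormedAddCommGroup Δ] [MeasureSpace Δ] [BorelSpace Δ]
  [SecondCountableTopology Δ] {β : ℝ} {V : Δ → ℝ}

/-- The partition function of the gas with an additional pair interaction `-k`, which also acts on
the diagonal. -/
def modifiedPartition (β : ℝ) (V : Δ → ℝ) (k : Δ → Δ → ℝ) (N : ℕ) : ℝ≥0∞ :=
  ∫⁻ x : Fin N → Δ, ENNReal.ofReal (density β V N x * Real.exp (∑ i, ∑ j, k (x i) (x j)))

omit [NormedAddCommGroup Δ] [BorelSpace Δ] [SecondCountableTopology Δ] in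
lemma measurable_sum_pairs {k : Δ → Δ → ℝ} (hk : Measurable fun p : Δ × Δ => k p.1 p.2) (N : ℕ) :
    Measurable fun x : Fin N → Δ => ∑ i, ∑ j, k (x i) (x j) :=
  Finset.measurable_fun_sum _ fun i _ => Finset.measurable_fun_sum _ fun j _ => by
    have h : Measurable fun x : Fin N → Δ => (x i, x j) := by fun_prop
    exact hk.comp h

/-- In the merged configuration only the cross pairs are new. Each carries the weight bounded in
`hle`, with a factor 2 because the double sum of `k` meets every pair in both orders; the diagonal
terms stay within their group. -/
lemma modifiedPartition_add_le [SigmaFinite (volume : Measure Δ)] (hV : Continuous V)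
    {k : Δ → Δ → ℝ} (hk : Measurable fun p : Δ × Δ => k p.1 p.2) (hsymm : ∀ x y, k x y = k y x)
    (hle : ∀ x y, ‖x - y‖ ^ β * Real.exp (-(V x + V y)) * Real.exp (2 * k x y) ≤ 1) (n m : ℕ) :
    modifiedPartition β V k (n + m) ≤ modifiedPartition β V k n * modifiedPartition β V k m := by
  have hmeas : ∀ N, Measurable fun x : Fin N → Δ =>
      ENNReal.ofReal (density β V N x * Real.exp (∑ i, ∑ j, k (x i) (x j))) := fun N =>
    ((measurable_density hV N).mul (measurable_sum_pairs hk N).exp).ennreal_ofReal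
  rw [modifiedPartition, ← (measurePreserving_append n m).lintegral_comp (hmeas _),
    modifiedPartition, modifiedPartition,
    ← lintegral_prod_mul (hmeas n).aemeasurable (hmeas m).aemeasurable]
  refine lintegral_mono fun p => ?_
  obtain ⟨x, y⟩ := p
  simp only
  rw [← ENNReal.ofReal_mul (mul_nonneg (density_nonneg _ _) (Real.exp_nonneg _))]
  refine ENNReal.ofReal_le_ofReal ?_
  have hsum : ∑ i, ∑ j, k (Fin.append x y i) (Fin.append x y j) =
      ∑ i, ∑ j, k (x i) (x j) + ∑ i, ∑ j, k (y i) (y j) + ∑ i, ∑ j, 2 * k (x i) (y j) := by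
    simp only [Fin.sum_univ_add, Fin.append_left, Fin.append_right, Finset.sum_add_distrib]
    have : ∑ i : Fin m, ∑ j : Fin n, k (y i) (x j) = ∑ i : Fin n, ∑ j : Fin m, k (x i) (y j) := by
      rw [Finset.sum_comm]
      simp only [hsymm (y _) (x _)]
    rw [this]
    simp only [← Finset.mul_sum]
    ring
  have hcross : (∏ i, ∏ j, (‖x i - y j‖ ^ β * Real.exp (-(V (x i) + V (y j))))) *
      Real.exp (∑ i, ∑ j, 2 * k (x i) (y j)) ≤ 1 := by
    simp only [Real.exp_sum]
    rw [← Finset.prod_mul_distrib]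
    simp only [← Finset.prod_mul_distrib]
    refine Finset.prod_le_one (fun i _ => Finset.prod_nonneg fun j _ => by positivity) fun i _ => ?_
    exact Finset.prod_le_one (fun j _ => by positivity) fun j _ => hle _ _
  rw [density_append, hsum, Real.exp_add, Real.exp_add]
  calc _ = (density β V n x * Real.exp (∑ i, ∑ j, k (x i) (x j)) *
        (density β V m y * Real.exp (∑ i, ∑ j, k (y i) (y j)))) *
        ((∏ i, ∏ j, (‖x i - y j‖ ^ β * Real.exp (-(V (x i) + V (y j))))) *
        Real.exp (∑ i, ∑ j, 2 * k (x i) (y j))) := by ring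
    _ ≤ _ := mul_le_of_le_one_right (mul_nonneg (mul_nonneg (density_nonneg _ _)
        (Real.exp_nonneg _)) (mul_nonneg (density_nonneg _ _) (Real.exp_nonneg _))) hcross

/-- A submultiplicative sequence which is eventually finite grows at most geometrically. -/
lemma exists_le_exp_of_submultiplicative {G : ℕ → ℝ≥0∞} (hG : ∀ n m, G (n + m) ≤ G n * G m)
    (hfin : ∀ᶠ n in atTop, G n < ⊤) :
    ∃ c : ℝ, ∀ᶠ n : ℕ in atTop, G n ≤ ENNReal.ofReal (Real.exp (c * n)) := by
  obtain ⟨M, hM⟩ := eventually_atTop.1 (hfin.and (eventually_ge_atTop 1))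
  have hM1 : 1 ≤ M := (hM M le_rfl).2
  -- `A` bounds `G` on the window from `M` to `2 * M - 1`, which removing blocks of length `M`
  -- always reaches without passing through the possibly infinite initial values.
  let A : ℝ≥0∞ := max 1 ((Finset.range (2 * M)).sup fun n => if M ≤ n then G n else 0)
  have hA1 : 1 ≤ A := le_max_left _ _
  have hAtop : A < ⊤ := by
    refine max_lt ENNReal.one_lt_top ((Finset.sup_lt_iff ENNReal.zero_lt_top).2 fun n _ => ?_)
    split_ifs with h
    · exact (hM n h).1
    · exact ENNReal.zero_lt_top
  have hGA : ∀ n, M ≤ n → n < 2 * M → G n ≤ A := fun n h1 h2 => by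
    refine le_trans ?_ (le_max_right _ _)
    have := Finset.le_sup (f := fun n => if M ≤ n then G n else 0) (Finset.mem_range.2 h2)
    simpa [h1] using this
  have key : ∀ n, M ≤ n → G n ≤ A ^ n := by
    intro n
    induction n using Nat.strong_induction_on with
    | _ n ih =>
      intro hn
      by_cases h2 : n < 2 * M
      · exact (hGA n hn h2).trans (le_self_pow₀ hA1 (by omega))
      · have h3 : n = (n - M) + M := by omega
        calc G n = G ((n - M) + M) := by rw [← h3]
          _ ≤ G (n - M) * G M := hG _ _
          _ ≤ A ^ (n - M) * A ^ M := by
            gcongr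
            · exact ih (n - M) (by omega) (by omega)
            · exact (hGA M le_rfl (by omega)).trans (le_self_pow₀ hA1 (by omega))
          _ = A ^ n := by rw [← pow_add, ← h3]
  refine ⟨Real.log A.toReal, eventually_atTop.2 ⟨M, fun n hn => (key n hn).trans ?_⟩⟩
  have hpos : 0 < A.toReal := ENNReal.toReal_pos (by positivity) hAtop.ne
  rw [mul_comm, Real.exp_nat_mul, Real.exp_log hpos, ENNReal.ofReal_pow hpos.le,
    ENNReal.ofReal_toReal hAtop.ne]

end Submultiplicative

/-! ### The large deviation upper bound for unnormalized measures. -/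

section UpperBound

variable {Δ : Type} [NormedAddCommGroup Δ] {β : ℝ} {V : Δ → ℝ} {C : ℝ}

omit [NormedAddCommGroup Δ] in
lemma lintegral_empiricalMeasure [MeasurableSpace Δ] {N : ℕ} (x : Fin N → Δ) {g : Δ → ℝ≥0∞}
    (hg : Measurable g) : ∫⁻ a, g a ∂(empiricalMeasure x) = (N : ℝ≥0∞)⁻¹ * ∑ i, g (x i) := by
  rw [empiricalMeasure, lintegral_smul_measure, lintegral_finsetSum_measure]
  simp [lintegral_dirac' _ hg]

/-- The interaction kernel truncated at level `L`. -/
def truncKernel (β : ℝ) (V : Δ → ℝ) (C : ℝ) (L : ℕ) (x y : Δ) : ℝ :=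
  (min (posKernel β V C x y) L).toReal

lemma truncKernel_nonneg (L : ℕ) (x y : Δ) : 0 ≤ truncKernel β V C L x y := ENNReal.toReal_nonneg

lemma truncKernel_le (L : ℕ) (x y : Δ) : truncKernel β V C L x y ≤ L := by
  have := ENNReal.toReal_mono (ENNReal.natCast_ne_top L) (min_le_right (posKernel β V C x y) L)
  simpa [truncKernel] using this

lemma ofReal_truncKernel (L : ℕ) (x y : Δ) :
    ENNReal.ofReal (truncKernel β V C L x y) = min (posKernel β V C x y) L :=
  ENNReal.ofReal_toReal ((min_le_right _ _).trans_lt (ENNReal.natCast_lt_top L)).ne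

/-- Off the diagonal the pair weight is `exp (-2 F)`, where `F` is the kernel, and truncating `F +
C` only lowers it. On the diagonal the weight vanishes, as `β > 0`. -/
lemma norm_rpow_mul_exp_le_one (hβ : 0 < β) (hC : ∀ x, β / 2 * Real.log (1 + ‖x‖ ^ 2) ≤ V x + C)
    (L : ℕ) (x y : Δ) : ‖x - y‖ ^ β * Real.exp (-(V x + V y)) *
      Real.exp (2 * (truncKernel β V C L x y - C)) ≤ 1 := by
  rcases eq_or_ne x y with rfl | h
  · simp [Real.zero_rpow hβ.ne']
  · have h0 : 0 < ‖x - y‖ := norm_pos_iff.2 (sub_ne_zero.2 h)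
    have h1 := kernel_real_nonneg hβ hC h
    have h2 : truncKernel β V C L x y ≤ -(β / 2) * Real.log ‖x - y‖ + (V x / 2 + V y / 2) + C := by
      rw [truncKernel, posKernel_of_ne h]
      refine (ENNReal.toReal_mono ENNReal.ofReal_ne_top (min_le_left _ _)).trans ?_
      rw [ENNReal.toReal_ofReal h1]
    rw [Real.rpow_def_of_pos h0, ← Real.exp_add, ← Real.exp_add, Real.exp_le_one_iff]
    linarith

variable [MeasureSpace Δ] [BorelSpace Δ] [SecondCountableTopology Δ]

lemma measurable_truncKernel (hV : Continuous V) (L : ℕ) :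
    Measurable fun p : Δ × Δ => truncKernel β V C L p.1 p.2 :=
  ((measurable_posKernel hV).min measurable_const).ennreal_toReal

omit [NormedAddCommGroup Δ] [BorelSpace Δ] [SecondCountableTopology Δ] in
lemma lintegral_prod_of_eq_empiricalMeasure {g : Δ × Δ → ℝ≥0∞} (hg : Measurable g) {N : ℕ}
    {x : Fin N → Δ} (μ : ProbabilityMeasure Δ) (hμ : (μ : Measure Δ) = empiricalMeasure x) :
    ∫⁻ p, g p ∂((μ : Measure Δ).prod (μ : Measure Δ)) =
      (N : ℝ≥0∞)⁻¹ * ((N : ℝ≥0∞)⁻¹ * ∑ i, ∑ j, g (x i, x j)) := by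
  rw [lintegral_prod _ hg.aemeasurable, hμ]
  have h1 : ∀ a, ∫⁻ b, g (a, b) ∂(empiricalMeasure x) = (N : ℝ≥0∞)⁻¹ * ∑ j, g (a, x j) := fun a =>
    lintegral_empiricalMeasure x (hg.comp measurable_prodMk_left)
  have h2 : Measurable fun a => ∑ j, g (a, x j) :=
    Finset.measurable_fun_sum _ fun j _ => hg.comp measurable_prodMk_right
  simp only [h1]
  rw [lintegral_empiricalMeasure x (h2.const_mul _), ← Finset.mul_sum]

lemma truncEnergy_of_eq_empiricalMeasure (hV : Continuous V) (L : ℕ) {N : ℕ} {x : Fin N → Δ}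
    (μ : ProbabilityMeasure Δ) (hμ : (μ : Measure Δ) = empiricalMeasure x) :
    truncEnergy (fun p : Δ × Δ => posKernel β V C p.1 p.2) L (μ : Measure Δ) =
      (N : ℝ≥0∞)⁻¹ * ((N : ℝ≥0∞)⁻¹ *
        ENNReal.ofReal (∑ i, ∑ j, truncKernel β V C L (x i) (x j))) := by
  have hm : Measurable fun p : Δ × Δ => min (posKernel β V C p.1 p.2) L :=
    (measurable_posKernel hV).min measurable_const
  rw [truncEnergy, lintegral_prod_of_eq_empiricalMeasure hm μ hμ]
  simp only [ENNReal.ofReal_sum_of_nonneg fun i _ =>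
      Finset.sum_nonneg fun j _ => truncKernel_nonneg _ _ _,
    ENNReal.ofReal_sum_of_nonneg fun j _ => truncKernel_nonneg _ _ _, ofReal_truncKernel]

/-- Exponential Chebyshev inequality: on the event the tilt is at least `exp ((t - C) * N ^ 2)`,
while its total integral is at most `exp (c * N)` by submultiplicativity. The gap `t - C - a`
absorbs the linear term. -/
lemma eventually_setLIntegral_density_le [SigmaFinite (volume : Measure Δ)] (hβ : 0 < β)
    (hV : Continuous V) (hC : ∀ x, β / 2 * Real.log (1 + ‖x‖ ^ 2) ≤ V x + C)
    (hZ : ∀ᶠ N in atTop, partitionFunction β V N < ⊤) {F : Set (ProbabilityMeasure Δ)} {L : ℕ}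
    {t a : ℝ} (hF : ∀ μ ∈ F, ENNReal.ofReal t ≤
      truncEnergy (fun p : Δ × Δ => posKernel β V C p.1 p.2) L (μ : Measure Δ)) (ha : a < t - C) :
    ∀ᶠ N : ℕ in atTop, ∫⁻ x in empiricalEvent F N, ENNReal.ofReal (density β V N x) ≤
      ENNReal.ofReal (Real.exp (-(a * (N : ℝ) ^ 2))) := by
  let k : Δ → Δ → ℝ := fun x y => truncKernel β V C L x y - C
  have hk : Measurable fun p : Δ × Δ => k p.1 p.2 := (measurable_truncKernel hV L).sub_const C
  have hsub := modifiedPartition_add_le hV hk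
    (fun x y => by simp only [k, truncKernel, posKernel_comm])
    (norm_rpow_mul_exp_le_one hβ hC L)
  -- Truncation makes the tilt bounded for each `N`, so it preserves finiteness of the integral.
  have hfin : ∀ᶠ N in atTop, modifiedPartition β V k N < ⊤ := by
    filter_upwards [hZ] with N hN
    calc modifiedPartition β V k N ≤ ∫⁻ x : Fin N → Δ, ENNReal.ofReal (density β V N x) *
          ENNReal.ofReal (Real.exp (∑ _i : Fin N, ∑ _j : Fin N, ((L : ℝ) - C))) := by
          refine lintegral_mono fun x => ?_
          rw [← ENNReal.ofReal_mul (density_nonneg _ _)]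
          refine ENNReal.ofReal_le_ofReal
            (mul_le_mul_of_nonneg_left (Real.exp_le_exp.2 ?_) (density_nonneg _ _))
          exact Finset.sum_le_sum fun i _ => Finset.sum_le_sum fun j _ =>
            sub_le_sub_right (truncKernel_le _ _ _) _
      _ = partitionFunction β V N * _ :=
          lintegral_mul_const _ (measurable_density hV N).ennreal_ofReal
      _ < ⊤ := ENNReal.mul_lt_top hN ENNReal.ofReal_lt_top
  obtain ⟨c, hc⟩ := exists_le_exp_of_submultiplicative hsub hfin
  have hlin : ∀ᶠ N : ℕ in atTop, c * N ≤ (t - C - a) * (N : ℝ) ^ 2 := by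
    filter_upwards [eventually_ge_atTop ⌈c / (t - C - a)⌉₊] with N hN
    have h1 : c / (t - C - a) ≤ N := Nat.ceil_le.1 hN
    rw [div_le_iff₀ (by linarith)] at h1
    have : (0 : ℝ) ≤ N := Nat.cast_nonneg N
    nlinarith
  filter_upwards [hc, hlin, eventually_ge_atTop 1] with N hcN hlinN hN
  have hN0 : (N : ℝ≥0∞) ≠ 0 := by exact_mod_cast (by omega : N ≠ 0)
  have hevent : empiricalEvent F N ⊆
      {x : Fin N → Δ | (t - C) * (N : ℝ) ^ 2 ≤ ∑ i, ∑ j, k (x i) (x j)} := by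
    rintro x ⟨μ, hμ, hx⟩
    have h1 := hF μ hμ
    rw [truncEnergy_of_eq_empiricalMeasure hV L μ hx, ← ENNReal.mul_le_iff_le_inv hN0 (by simp),
      ← ENNReal.mul_le_iff_le_inv hN0 (by simp), ← ENNReal.ofReal_natCast,
      ← ENNReal.ofReal_mul (by positivity), ← ENNReal.ofReal_mul (by positivity),
      ENNReal.ofReal_le_ofReal_iff (Finset.sum_nonneg fun i _ => Finset.sum_nonneg fun j _ =>
        truncKernel_nonneg _ _ _)] at h1
    simp only [k, Set.mem_ofPred_eq, Finset.sum_sub_distrib, Finset.sum_const, Finset.card_univ,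
      Fintype.card_fin, nsmul_eq_mul]
    linarith
  have hS : MeasurableSet {x : Fin N → Δ | (t - C) * (N : ℝ) ^ 2 ≤ ∑ i, ∑ j, k (x i) (x j)} :=
    measurableSet_le measurable_const (measurable_sum_pairs hk N)
  calc ∫⁻ x in empiricalEvent F N, ENNReal.ofReal (density β V N x)
      ≤ ∫⁻ x in {x : Fin N → Δ | (t - C) * (N : ℝ) ^ 2 ≤ ∑ i, ∑ j, k (x i) (x j)},
          ENNReal.ofReal (density β V N x) := lintegral_mono_set hevent
    _ ≤ ∫⁻ x in {x : Fin N → Δ | (t - C) * (N : ℝ) ^ 2 ≤ ∑ i, ∑ j, k (x i) (x j)},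
          ENNReal.ofReal (density β V N x * Real.exp (∑ i, ∑ j, k (x i) (x j))) *
            ENNReal.ofReal (Real.exp (-((t - C) * (N : ℝ) ^ 2))) := by
        refine setLIntegral_mono' hS fun x hx => ?_
        rw [← ENNReal.ofReal_mul (mul_nonneg (density_nonneg _ _) (Real.exp_nonneg _)), mul_assoc,
          ← Real.exp_add]
        refine ENNReal.ofReal_le_ofReal (le_mul_of_one_le_right (density_nonneg _ _) ?_)
        exact Real.one_le_exp (by rw [Set.mem_ofPred_eq] at hx; linarith)
    _ ≤ ∫⁻ x : Fin N → Δ, ENNReal.ofReal (density β V N x * Real.exp (∑ i, ∑ j, k (x i) (x j))) *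
            ENNReal.ofReal (Real.exp (-((t - C) * (N : ℝ) ^ 2))) := setLIntegral_le_lintegral _ _
    _ = modifiedPartition β V k N * ENNReal.ofReal (Real.exp (-((t - C) * (N : ℝ) ^ 2))) :=
        lintegral_mul_const' _ _ ENNReal.ofReal_ne_top
    _ ≤ ENNReal.ofReal (Real.exp (c * N)) *
          ENNReal.ofReal (Real.exp (-((t - C) * (N : ℝ) ^ 2))) := by gcongr
    _ ≤ _ := by
        rw [← ENNReal.ofReal_mul (Real.exp_nonneg _), ← Real.exp_add]
        refine ENNReal.ofReal_le_ofReal (Real.exp_le_exp.2 ?_)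
        linarith

/-- The large deviation upper bound for the unnormalized measures. -/
lemma eventually_setLIntegral_density_le_of_isClosed [ProperSpace Δ]
    [SigmaFinite (volume : Measure Δ)] (hβ : 0 < β)
    (hV : Continuous V) (hC : ∀ x, β / 2 * Real.log (1 + ‖x‖ ^ 2) ≤ V x + C)
    (hZ : ∀ᶠ N in atTop, partitionFunction β V N < ⊤) {F : Set (ProbabilityMeasure Δ)}
    (hF : IsClosed F) {a b : ℝ} (hab : a < b) (hb : ∀ μ ∈ F, (b : EReal) < energy β V μ) :
    ∀ᶠ N : ℕ in atTop, ∫⁻ x in empiricalEvent F N, ENNReal.ofReal (density β V N x) ≤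
      ENNReal.ofReal (Real.exp (-(a * (N : ℝ) ^ 2))) := by
  have hL : ∃ L : ℕ, ∀ μ ∈ F, ENNReal.ofReal (b + C) ≤
      truncEnergy (fun p : Δ × Δ => posKernel β V C p.1 p.2) L (μ : Measure Δ) := by
    rcases le_or_gt (b + C) 0 with h | h
    -- If `b + C ≤ 0`, nonnegativity of the truncated energy suffices.
    · exact ⟨0, fun μ _ => by simp [ENNReal.ofReal_of_nonpos h]⟩
    · obtain ⟨L, hL⟩ := exists_forall_lt_truncEnergy (continuous_posKernel hV)
        (blowsUpAtInfinity_posKernel hβ hC) (ENNReal.ofReal_ne_top (r := b + C)) hF (by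
          intro μ hμ
          have h1 := hb μ hμ
          rw [energy_eq hβ hV hC, mutualEnergy_eq_lintegral_prod hV,
            EReal.lt_sub_iff_add_lt (by simp) (by simp), ← EReal.coe_add] at h1
          rw [← EReal.coe_ennreal_lt_coe_ennreal_iff, EReal.coe_ennreal_ofReal, max_eq_left h.le]
          exact h1)
      exact ⟨L, fun μ hμ => (hL μ hμ).le⟩
  obtain ⟨L, hL⟩ := hL
  exact eventually_setLIntegral_density_le hβ hV hC hZ hL (by linarith)

end UpperBound

end CoulombGas

namespace CoulombGas

/-! ### The weak law of large numbers for empirical measures. -/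

section LawOfLargeNumbers

variable {Δ : Type} [MeasurableSpace Δ]

lemma isProbabilityMeasure_empiricalMeasure {N : ℕ} (hN : N ≠ 0) (x : Fin N → Δ) :
    IsProbabilityMeasure (empiricalMeasure x) := ⟨by
  have : (N : ℝ≥0∞) ≠ 0 := by exact_mod_cast hN
  simp [empiricalMeasure, ENNReal.inv_mul_cancel this]⟩

lemma empiricalEvent_univ {N : ℕ} (hN : N ≠ 0) :
    empiricalEvent (Set.univ : Set (ProbabilityMeasure Δ)) N = Set.univ :=
  Set.eq_univ_of_forall fun x =>
    ⟨⟨empiricalMeasure x, isProbabilityMeasure_empiricalMeasure hN x⟩, Set.mem_univ _, rfl⟩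

lemma empiricalEvent_mono {A B : Set (ProbabilityMeasure Δ)} (h : A ⊆ B) (N : ℕ) :
    empiricalEvent A N ⊆ empiricalEvent B N := fun _ ⟨μ, hμ, hx⟩ => ⟨μ, h hμ, hx⟩

lemma empiricalEvent_inter (A B : Set (ProbabilityMeasure Δ)) (N : ℕ) :
    empiricalEvent (A ∩ B) N = empiricalEvent A N ∩ empiricalEvent B N := by
  refine Set.Subset.antisymm (Set.subset_inter (empiricalEvent_mono Set.inter_subset_left N)
    (empiricalEvent_mono Set.inter_subset_right N)) ?_
  rintro x ⟨⟨μ, hμ, hx⟩, ⟨ν, hν, hx'⟩⟩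
  have : ν = μ := Subtype.ext (hx'.trans hx.symm)
  exact ⟨μ, ⟨hμ, this ▸ hν⟩, hx⟩

/-- The sets of probability measures to which the empirical measures of independent samples of `μ`
belong with probability tending to one. -/
def samplingFilter (μ : Measure Δ) [IsProbabilityMeasure μ] : Filter (ProbabilityMeasure Δ) where
  sets := {S | Tendsto (fun N : ℕ => Measure.pi (fun _ : Fin N => μ) (empiricalEvent S N)ᶜ)
    atTop (𝓝 0)}
  univ_sets := by
    refine tendsto_const_nhds.congr' ?_
    filter_upwards [eventually_ne_atTop 0] with N hN
    simp [empiricalEvent_univ hN]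
  sets_of_superset := fun {S T} hS hST =>
    tendsto_of_tendsto_of_tendsto_of_le_of_le tendsto_const_nhds hS (fun _ => zero_le)
      fun N => measure_mono (Set.compl_subset_compl.2 (empiricalEvent_mono hST N))
  inter_sets := fun {S T} hS hT => by
    have h := hS.add hT
    rw [add_zero] at h
    refine tendsto_of_tendsto_of_tendsto_of_le_of_le tendsto_const_nhds h (fun _ => zero_le)
      fun N => ?_
    simp only [empiricalEvent_inter, Set.compl_inter]
    exact measure_union_le _ _

variable [TopologicalSpace Δ] [OpensMeasurableSpace Δ]

/-- The weak law of large numbers for empirical measures. -/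
lemma samplingFilter_le_nhds (μ : ProbabilityMeasure Δ) :
    samplingFilter (μ : Measure Δ) ≤ 𝓝 μ := by
  -- Events of probability tending to one form a filter, so weak convergence can be tested on one
  -- bounded continuous function at a time, where Chebyshev's inequality applies.
  change Tendsto id (samplingFilter (μ : Measure Δ)) (𝓝 μ)
  refine ProbabilityMeasure.tendsto_iff_forall_integral_tendsto.2 fun f => ?_
  refine Metric.tendsto_nhds.2 fun ε hε => ?_
  change Tendsto _ _ _
  have hf : MemLp f 2 (μ : Measure Δ) :=
    MemLp.of_bound f.continuous.measurable.aestronglyMeasurable ‖f‖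
      (Eventually.of_forall fun x => f.norm_coe_le_norm x)
  set v := ProbabilityTheory.variance f (μ : Measure Δ) with hv
  have hlim : Tendsto (fun N : ℕ => ENNReal.ofReal (N * v / (ε * N) ^ 2)) atTop (𝓝 0) := by
    rw [← ENNReal.ofReal_zero]
    refine ENNReal.tendsto_ofReal ?_
    have h1 : Tendsto (fun N : ℕ => v / ε ^ 2 / (N : ℝ)) atTop (𝓝 0) :=
      tendsto_const_div_atTop_nhds_zero_nat _
    refine h1.congr' ?_
    filter_upwards [eventually_ne_atTop 0] with N hN
    have : (N : ℝ) ≠ 0 := by exact_mod_cast hN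
    field_simp
  refine tendsto_of_tendsto_of_tendsto_of_le_of_le' tendsto_const_nhds hlim
    (Eventually.of_forall fun _ => zero_le) ?_
  filter_upwards [eventually_ne_atTop 0] with N hN
  have hNpos : (0 : ℝ) < N := by exact_mod_cast Nat.pos_of_ne_zero hN
  have hXi : ∀ i : Fin N, MemLp (fun x : Fin N → Δ => f (x i)) 2
      (Measure.pi fun _ : Fin N => (μ : Measure Δ)) := fun i =>
    hf.comp_measurePreserving (measurePreserving_eval _ i)
  have hX : MemLp (∑ i : Fin N, fun x : Fin N → Δ => f (x i)) 2
      (Measure.pi fun _ : Fin N => (μ : Measure Δ)) := memLp_finsetSum' _ fun i _ => hXi i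
  have hmean : ∫ x, (∑ i : Fin N, fun x : Fin N → Δ => f (x i)) x
      ∂(Measure.pi fun _ : Fin N => (μ : Measure Δ)) = N * ∫ a, f a ∂(μ : Measure Δ) := by
    simp only [Finset.sum_apply]
    rw [integral_finsetSum _ fun i _ => (hXi i).integrable (by norm_num)]
    have : ∀ i : Fin N, ∫ x : Fin N → Δ, f (x i) ∂(Measure.pi fun _ : Fin N => (μ : Measure Δ)) =
        ∫ a, f a ∂(μ : Measure Δ) := fun i =>
      integral_comp_eval (μ := fun _ : Fin N => (μ : Measure Δ)) (i := i)
        f.continuous.measurable.aestronglyMeasurable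
    simp [this]
  have hvar : ProbabilityTheory.variance (∑ i : Fin N, fun x : Fin N → Δ => f (x i))
      (Measure.pi fun _ : Fin N => (μ : Measure Δ)) = N * v := by
    rw [ProbabilityTheory.variance_sum_pi fun _ => hf]
    simp [hv]
  have hcheb := ProbabilityTheory.meas_ge_le_variance_div_sq hX (mul_pos hε hNpos)
  rw [hvar, hmean] at hcheb
  refine (measure_mono fun x hx => ?_).trans hcheb
  rw [Set.mem_ofPred_eq]
  by_contra! hlt
  refine hx ⟨⟨empiricalMeasure x, isProbabilityMeasure_empiricalMeasure hN x⟩, ?_, rfl⟩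
  have hint : ∫ a, f a ∂(empiricalMeasure x) = (N : ℝ)⁻¹ * ∑ i, f (x i) := by
    rw [empiricalMeasure, integral_smul_measure, integral_finsetSum_measure]
    · have : ∀ i, ∫ a, f a ∂(Measure.dirac (x i)) = f (x i) := fun i =>
        integral_dirac' _ _ f.continuous.measurable.stronglyMeasurable
      simp [this]
    · exact fun i _ => f.integrable _
  change dist (∫ a, f a ∂(empiricalMeasure x)) _ < ε
  rw [hint, Real.dist_eq]
  have : (N : ℝ)⁻¹ * ∑ i, f (x i) - ∫ a, f a ∂(μ : Measure Δ) =
      (N : ℝ)⁻¹ * ((∑ i : Fin N, fun x : Fin N → Δ => f (x i)) x -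
        N * ∫ a, f a ∂(μ : Measure Δ)) := by
    rw [mul_sub, inv_mul_cancel_left₀ hNpos.ne', Finset.sum_apply]
  rw [this, abs_mul, abs_of_pos (inv_pos.2 hNpos), inv_mul_lt_iff₀ hNpos]
  linarith

end LawOfLargeNumbers

/-! ### Product measures. -/

section Pi

variable {Δ : Type} [MeasurableSpace Δ]

/-- This turns a probability bound for independent samples into a Lebesgue volume bound, at the
price of a factor `c ^ N` that is negligible at speed `N ^ 2`. -/
lemma pi_le_smul_pi {ν lam : Measure Δ} [SigmaFinite ν] [SigmaFinite lam] {c : ℝ≥0∞}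
    (h : ν ≤ c • lam) (N : ℕ) :
    Measure.pi (fun _ : Fin N => ν) ≤ c ^ N • Measure.pi (fun _ : Fin N => lam) := by
  induction N with
  | zero =>
    rw [pow_zero, one_smul, Measure.pi_of_empty, Measure.pi_of_empty]
  | succ N ih =>
    have h1 := (measurePreserving_piFinSuccAbove (fun _ : Fin (N + 1) => ν) 0).symm
    have h2 := (measurePreserving_piFinSuccAbove (fun _ : Fin (N + 1) => lam) 0).symm
    rw [← h1.map_eq, ← h2.map_eq, ← Measure.map_smul]
    refine Measure.map_mono ?_ h1.measurable
    calc ν.prod (Measure.pi fun _ : Fin N => ν)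
        ≤ (c • lam).prod (c ^ N • Measure.pi fun _ : Fin N => lam) := by
          exact Measure.prod_mono h ih
      _ = _ := by
          rw [Measure.prod_smul_left, Measure.prod_smul_right, smul_smul, pow_succ']

lemma map_pair_pi (ν : Measure Δ) [IsProbabilityMeasure ν] {N : ℕ} {i j : Fin N} (hij : i ≠ j) :
    (Measure.pi fun _ : Fin N => ν).map (fun x => (x i, x j)) = ν.prod ν := by
  have h := (ProbabilityTheory.iIndepFun_pi (μ := fun _ : Fin N => ν) (X := fun _ a => a)
    fun _ => aemeasurable_id).indepFun hij
  have hk := fun k : Fin N => (measurePreserving_eval (fun _ : Fin N => ν) k).map_eq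
  have h1 := h.map_prod_eq_prod_map_map (measurable_pi_apply i).aemeasurable
    (measurable_pi_apply j).aemeasurable
  rw [h1]
  exact congrArg₂ Measure.prod (hk i) (hk j)

end Pi

/-! ### The lower bound around measures with bounded density. -/

section LowerBound

variable {Δ : Type} [NormedAddCommGroup Δ] {β : ℝ} {V : Δ → ℝ} {C : ℝ}

/-- The interaction energy of a configuration. -/
def pairEnergy (β : ℝ) (V : Δ → ℝ) (C : ℝ) {N : ℕ} (x : Fin N → Δ) : ℝ≥0∞ :=
  ∑ i, ∑ j ∈ Finset.Ioi i, 2 * posKernel β V C (x i) (x j)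

/-- Each index belongs to `N - 1` pairs. -/
lemma sum_Ioi_add {N : ℕ} (f : Fin N → ℝ) :
    ∑ i, ∑ j ∈ Finset.Ioi i, (f i + f j) = (N - 1) * ∑ i, f i := by
  have h := Finset.sum_sum_Ioi_add_eq_sum_sum_off_diag fun _ j : Fin N => f j
  have h1 : ∀ i : Fin N, ∑ j ∈ ({i}ᶜ : Finset (Fin N)), f i = (N - 1) * f i := by
    intro i
    have : 1 ≤ N := by have := i.2; omega
    simp [Finset.card_compl, Nat.cast_sub this]
  rw [h, Finset.sum_congr rfl fun i _ => h1 i, Finset.mul_sum]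

/-- Of the `N` copies of `V (x i)`, `N - 1` are used by the pairs containing `i` and one is left
over. Each of the `N * (N - 1) / 2` pairs returns `2 * C` from the shift. -/
lemma density_eq_exp (hβ : 0 < β) (hC : ∀ x, β / 2 * Real.log (1 + ‖x‖ ^ 2) ≤ V x + C) {N : ℕ}
    {x : Fin N → Δ} (hx : pairEnergy β V C x ≠ ⊤) :
    density β V N x =
      Real.exp (-(pairEnergy β V C x).toReal + (N - 1) * N * C - ∑ i, V (x i)) := by
  have hfin : ∀ i, ∀ j ∈ Finset.Ioi i, 2 * posKernel β V C (x i) (x j) ≠ ⊤ := fun i j hj => by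
    have h1 := (ENNReal.sum_ne_top.1 hx) i (Finset.mem_univ i)
    exact (ENNReal.sum_ne_top.1 h1) j hj
  have hterm : ∀ i, ∀ j ∈ Finset.Ioi i, ‖x i - x j‖ ^ β =
      Real.exp (-(2 * posKernel β V C (x i) (x j)).toReal + ((V (x i) + C) + (V (x j) + C))) := by
    intro i j hj
    have hne : x i ≠ x j := fun h => hfin i j hj (by
      rw [h, posKernel_self hβ, ENNReal.mul_top (by simp)])
    have h0 : 0 < ‖x i - x j‖ := norm_pos_iff.2 (sub_ne_zero.2 hne)
    rw [posKernel_of_ne hne, ENNReal.toReal_mul,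
      ENNReal.toReal_ofReal (kernel_real_nonneg hβ hC hne), Real.rpow_def_of_pos h0]
    congr 1
    simp only [ENNReal.toReal_ofNat]
    ring
  rw [density]
  have h1 : ∏ i, ∏ j ∈ Finset.Ioi i, ‖x i - x j‖ ^ β =
      Real.exp (∑ i, ∑ j ∈ Finset.Ioi i,
        (-(2 * posKernel β V C (x i) (x j)).toReal + ((V (x i) + C) + (V (x j) + C)))) := by
    simp only [Real.exp_sum]
    exact Finset.prod_congr rfl fun i _ => Finset.prod_congr rfl fun j hj => hterm i j hj
  have h2 : (pairEnergy β V C x).toReal =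
      ∑ i, ∑ j ∈ Finset.Ioi i, (2 * posKernel β V C (x i) (x j)).toReal := by
    rw [pairEnergy, ENNReal.toReal_sum fun i _ => (ENNReal.sum_ne_top.2 (hfin i))]
    exact Finset.sum_congr rfl fun i _ => ENNReal.toReal_sum (hfin i)
  rw [h1, h2, ← Real.exp_sum, ← Real.exp_add]
  congr 1
  simp only [Finset.sum_add_distrib (f := fun j => -(2 * posKernel β V C (x _) (x j)).toReal),
    Finset.sum_add_distrib (f := fun i => ∑ j ∈ Finset.Ioi i, -(2 * posKernel β V C (x i) (x j)).toReal)]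
  rw [sum_Ioi_add fun i => V (x i) + C]
  simp only [Finset.sum_neg_distrib, Finset.sum_add_distrib, Finset.sum_const, Finset.card_univ,
    Fintype.card_fin, nsmul_eq_mul, ← Finset.mul_sum]
  ring

variable [MeasureSpace Δ] [BorelSpace Δ] [SecondCountableTopology Δ]

lemma measurable_pairEnergy (hV : Continuous V) (N : ℕ) :
    Measurable fun x : Fin N → Δ => pairEnergy β V C x :=
  Finset.measurable_fun_sum _ fun i _ => Finset.measurable_fun_sum _ fun j _ => by
    have h : Measurable fun x : Fin N → Δ => (x i, x j) := by fun_prop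
    exact ((measurable_posKernel hV).comp h).const_mul _

lemma lintegral_pairEnergy_le (hV : Continuous V) (ν : Measure Δ) [IsProbabilityMeasure ν]
    (N : ℕ) : ∫⁻ x, pairEnergy β V C x ∂(Measure.pi fun _ : Fin N => ν) ≤
      (N : ℝ≥0∞) ^ 2 * mutualEnergy β V C ν ν := by
  have hm : ∀ i j : Fin N, Measurable fun x : Fin N → Δ => 2 * posKernel β V C (x i) (x j) :=
    fun i j => by
      have h : Measurable fun x : Fin N → Δ => (x i, x j) := by fun_prop
      exact ((measurable_posKernel hV).comp h).const_mul _
  have hij : ∀ i, ∀ j ∈ Finset.Ioi i, ∫⁻ x, 2 * posKernel β V C (x i) (x j)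
      ∂(Measure.pi fun _ : Fin N => ν) = 2 * mutualEnergy β V C ν ν := by
    intro i j hj
    have h : Measurable fun x : Fin N → Δ => (x i, x j) := by fun_prop
    rw [lintegral_const_mul' _ _ (by simp),
      mutualEnergy_eq_lintegral_prod hV, ← map_pair_pi ν (Finset.mem_Ioi.1 hj).ne,
      lintegral_map (measurable_posKernel hV) h]
  simp only [pairEnergy]
  rw [lintegral_finsetSum _ fun i _ => Finset.measurable_fun_sum _ fun j _ => hm i j]
  have h1 : ∀ i : Fin N, ∫⁻ x, ∑ j ∈ Finset.Ioi i, 2 * posKernel β V C (x i) (x j)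
      ∂(Measure.pi fun _ : Fin N => ν) = ∑ j ∈ Finset.Ioi i, 2 * mutualEnergy β V C ν ν := by
    intro i
    rw [lintegral_finsetSum _ fun j _ => hm i j]
    exact Finset.sum_congr rfl (hij i)
  simp only [h1]
  simp only [two_mul]
  rw [Finset.sum_sum_Ioi_add_eq_sum_sum_off_diag fun _ _ : Fin N => mutualEnergy β V C ν ν]
  calc ∑ i : Fin N, ∑ j ∈ ({i}ᶜ : Finset (Fin N)), mutualEnergy β V C ν ν
      ≤ ∑ _i : Fin N, ∑ _j : Fin N, mutualEnergy β V C ν ν :=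
        Finset.sum_le_sum fun i _ => Finset.sum_le_sum_of_subset (Finset.subset_univ _)
    _ = _ := by simp [sq, mul_assoc]

/-- The lower bound for the unnormalized measures around a nice measure. -/
lemma eventually_le_setLIntegral_density_of_le_smul [SigmaFinite (volume : Measure Δ)] (hβ : 0 < β)
    (hV : Continuous V) (hC : ∀ x, β / 2 * Real.log (1 + ‖x‖ ^ 2) ≤ V x + C)
    {O : Set (ProbabilityMeasure Δ)} {ν : ProbabilityMeasure Δ} (hO : O ∈ 𝓝 ν) {c B e b : ℝ}
    (hc : 0 < c) (hνc : (ν : Measure Δ) ≤ ENNReal.ofReal c • volume)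
    (hB : ∀ᵐ x ∂(ν : Measure Δ), V x ≤ B)
    (he : mutualEnergy β V C (ν : Measure Δ) ν < ENNReal.ofReal e) (hb : e - C < b) :
    ∀ᶠ N : ℕ in atTop, ENNReal.ofReal (Real.exp (-(b * (N : ℝ) ^ 2))) ≤
      ∫⁻ x in empiricalEvent O N, ENNReal.ofReal (density β V N x) := by
  obtain ⟨κ, hκ, hκb⟩ : ∃ κ : ℝ, 0 < κ ∧ e - C + κ ≤ b := ⟨b - (e - C), by linarith, by linarith⟩
  have he0 : 0 < e := by
    by_contra! h
    simp [ENNReal.ofReal_of_nonpos h] at he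
  obtain ⟨m, hm0, hm⟩ : ∃ m : ℝ, 0 ≤ m ∧ mutualEnergy β V C (ν : Measure Δ) ν = ENNReal.ofReal m :=
    ⟨_, ENNReal.toReal_nonneg, (ENNReal.ofReal_toReal he.ne_top).symm⟩
  rw [hm, ENNReal.ofReal_lt_ofReal_iff he0] at he
  -- Markov's inequality loses probability at most `m / e` and the law of large numbers at most `δ`,
  -- which leaves `δ`.
  obtain ⟨δ, hδ, hδm⟩ : ∃ δ : ℝ, 0 < δ ∧ m / e + δ + δ = 1 := by
    have : m / e < 1 := (div_lt_one he0).2 he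
    exact ⟨(1 - m / e) / 2, by linarith, by ring⟩
  have hlln : ∀ᶠ N : ℕ in atTop, Measure.pi (fun _ : Fin N => (ν : Measure Δ))
      (empiricalEvent O N)ᶜ ≤ ENNReal.ofReal δ := by
    have h : Tendsto (fun N : ℕ => Measure.pi (fun _ : Fin N => (ν : Measure Δ))
      (empiricalEvent O N)ᶜ) atTop (𝓝 0) := samplingFilter_le_nhds ν hO
    exact ENNReal.tendsto_nhds_zero.1 h _ (ENNReal.ofReal_pos.2 hδ)
  -- `K * N` dominates every contribution of order lower than `N ^ 2`: the leftover potentials and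
  -- shift, the factor `c ^ N`, and the probability `δ`.
  set K : ℝ := |B + C| + |Real.log c| + |Real.log δ| with hK
  have hlin : ∀ᶠ N : ℕ in atTop, K * N ≤ κ * (N : ℝ) ^ 2 := by
    filter_upwards [eventually_ge_atTop ⌈K / κ⌉₊] with N hN
    have h1 : K / κ ≤ N := Nat.ceil_le.1 hN
    rw [div_le_iff₀ hκ] at h1
    have : (0 : ℝ) ≤ N := Nat.cast_nonneg N
    nlinarith
  filter_upwards [hlln, hlin, eventually_ge_atTop 1] with N hNlln hNlin hN
  have hN1 : (1 : ℝ) ≤ N := by exact_mod_cast hN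
  set P := Measure.pi (fun _ : Fin N => (ν : Measure Δ)) with hP
  set A := empiricalEvent O N with hA
  let S : Set (Fin N → Δ) :=
    {x | pairEnergy β V C x < ENNReal.ofReal ((N : ℝ) ^ 2 * e) ∧ ∀ i, V (x i) ≤ B}
  have hSc : P Sᶜ ≤ ENNReal.ofReal (m / e) := by
    have h1 : ∀ᵐ x ∂P, ∀ i, V (x i) ≤ B :=
      ae_all_iff.2 fun i => (Measure.tendsto_eval_ae_ae
      (μ := fun _ : Fin N => (ν : Measure Δ)) (i := i)).eventually hB
    have h2 : P {x | ENNReal.ofReal ((N : ℝ) ^ 2 * e) ≤ pairEnergy β V C x} ≤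
        ENNReal.ofReal (m / e) := by
      refine (meas_ge_le_lintegral_div (measurable_pairEnergy hV N).aemeasurable
        (ENNReal.ofReal_pos.2 (by positivity)).ne' ENNReal.ofReal_ne_top).trans ?_
      refine (ENNReal.div_le_div_right (lintegral_pairEnergy_le hV (ν : Measure Δ) N) _).trans ?_
      rw [hm, ← ENNReal.ofReal_natCast, ← ENNReal.ofReal_pow (by positivity),
        ← ENNReal.ofReal_mul (by positivity), ← ENNReal.ofReal_div_of_pos (by positivity),
        mul_div_mul_left _ _ (by positivity)]
    calc P Sᶜ ≤ P ({x | ENNReal.ofReal ((N : ℝ) ^ 2 * e) ≤ pairEnergy β V C x} ∪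
          {x | ¬ ∀ i, V (x i) ≤ B}) := measure_mono fun x hx => by
            by_contra h
            simp only [Set.mem_union, Set.mem_ofPred_eq, not_or, not_le, not_not] at h
            exact hx h
      _ ≤ _ := measure_union_le _ _
      _ ≤ _ := by
          rw [show P {x | ¬ ∀ i, V (x i) ≤ B} = 0 from ae_iff.1 h1, add_zero]
          exact h2
  have hAS : ENNReal.ofReal δ ≤ P (A ∩ S) := by
    have h1 : (1 : ℝ≥0∞) ≤ P (A ∩ S) + (ENNReal.ofReal δ + ENNReal.ofReal (m / e)) := by
      calc (1 : ℝ≥0∞) = P Set.univ := by simp [hP]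
        _ ≤ P (A ∩ S ∪ (Aᶜ ∪ Sᶜ)) := measure_mono fun x _ => by
            by_cases hxA : x ∈ A <;> by_cases hxS : x ∈ S <;> simp [hxA, hxS]
        _ ≤ P (A ∩ S) + P (Aᶜ ∪ Sᶜ) := measure_union_le _ _
        _ ≤ _ := by
            gcongr
            exact (measure_union_le _ _).trans (add_le_add hNlln hSc)
    have h2 : (1 : ℝ≥0∞) = ENNReal.ofReal δ + (ENNReal.ofReal δ + ENNReal.ofReal (m / e)) := by
      rw [← ENNReal.ofReal_add (by positivity) (by positivity),
        ← ENNReal.ofReal_add (by positivity) (by positivity), ← ENNReal.ofReal_one]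
      congr 1
      linarith
    rw [h2] at h1
    exact (ENNReal.add_le_add_iff_right (by simp)).1 h1
  have hvol : ENNReal.ofReal (δ * (c ^ N)⁻¹) ≤ volume (A ∩ S) := by
    have h1 := Measure.le_iff'.1 (pi_le_smul_pi hνc N) (A ∩ S)
    rw [Measure.smul_apply, smul_eq_mul, ← ENNReal.ofReal_pow hc.le, ← volume_pi] at h1
    have h2 := hAS.trans h1
    rw [mul_comm, ENNReal.ofReal_mul (by positivity), ENNReal.ofReal_inv_of_pos (by positivity),
      ENNReal.inv_mul_le_iff (by positivity) ENNReal.ofReal_ne_top]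
    exact h2
  have hdens : ∀ x ∈ A ∩ S, ENNReal.ofReal
      (Real.exp (-((N : ℝ) ^ 2 * e) + (N - 1) * N * C - N * B)) ≤
        ENNReal.ofReal (density β V N x) := by
    rintro x ⟨-, hx1, hx2⟩
    refine ENNReal.ofReal_le_ofReal ?_
    rw [density_eq_exp hβ hC hx1.ne_top]
    refine Real.exp_le_exp.2 ?_
    have h1 : (pairEnergy β V C x).toReal ≤ (N : ℝ) ^ 2 * e :=
      ENNReal.toReal_le_of_le_ofReal (by positivity) hx1.le
    have h2 : ∑ i, V (x i) ≤ N * B := by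
      calc ∑ i, V (x i) ≤ ∑ _i : Fin N, B := Finset.sum_le_sum fun i _ => hx2 i
        _ = _ := by simp
    linarith
  calc ENNReal.ofReal (Real.exp (-(b * (N : ℝ) ^ 2)))
      ≤ ENNReal.ofReal (Real.exp (-((N : ℝ) ^ 2 * e) + (N - 1) * N * C - N * B)) *
          ENNReal.ofReal (δ * (c ^ N)⁻¹) := by
        rw [← ENNReal.ofReal_mul (Real.exp_nonneg _)]
        refine ENNReal.ofReal_le_ofReal ?_
        rw [← Real.exp_log hδ, ← Real.exp_log hc, ← Real.exp_nat_mul, ← Real.exp_neg,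
          ← Real.exp_add, ← Real.exp_add, Real.exp_le_exp]
        have h1 : |B + C| * N + |Real.log c| * N + |Real.log δ| ≤ K * N := by
          rw [hK, add_mul, add_mul]
          gcongr
          exact le_mul_of_one_le_right (abs_nonneg _) hN1
        have h2 : (B + C) * N ≤ |B + C| * N := by gcongr; exact le_abs_self _
        have h3 : Real.log c * N ≤ |Real.log c| * N := by gcongr; exact le_abs_self _
        have h4 := neg_abs_le (Real.log δ)
        have h5 : (e - C + κ) * (N : ℝ) ^ 2 ≤ b * (N : ℝ) ^ 2 := by gcongr
        nlinarith
    _ ≤ ENNReal.ofReal (Real.exp (-((N : ℝ) ^ 2 * e) + (N - 1) * N * C - N * B)) *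
          volume (A ∩ S) := by gcongr
    _ = ∫⁻ _ in A ∩ S, ENNReal.ofReal
          (Real.exp (-((N : ℝ) ^ 2 * e) + (N - 1) * N * C - N * B)) := by
        rw [setLIntegral_const]
    _ ≤ ∫⁻ x in A ∩ S, ENNReal.ofReal (density β V N x) :=
        setLIntegral_mono (measurable_density hV N).ennreal_ofReal hdens
    _ ≤ _ := lintegral_mono_set Set.inter_subset_left

end LowerBound

end CoulombGas

namespace CoulombGas

/-! ### Approximation in energy by conditioning and mollification. -/

section Approximation

variable {Δ : Type} [NormedAddCommGroup Δ] [MeasurableSpace Δ] [BorelSpace Δ]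
  [SecondCountableTopology Δ] {β : ℝ} {V : Δ → ℝ} {C : ℝ}

omit [SecondCountableTopology Δ] in
-- Conditioning on a large ball multiplies the energy by at most the inverse square of the mass of
-- the ball, because the shifted kernel is nonnegative, and that mass tends to 1.
lemma exists_bounded_mem {μ : ProbabilityMeasure Δ} {O : Set (ProbabilityMeasure Δ)}
    (hO : O ∈ 𝓝 μ) {e : ℝ≥0∞} (he : mutualEnergy β V C (μ : Measure Δ) μ < e) :
    ∃ R : ℝ, ∃ ν ∈ O, mutualEnergy β V C (ν : Measure Δ) ν < e ∧
      ∀ᵐ x ∂(ν : Measure Δ), x ∈ Metric.closedBall 0 R := by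
  let s : ℕ → Set Δ := fun n => Metric.closedBall 0 n
  have hs : ∀ n, MeasurableSet (s n) := fun n => Metric.isClosed_closedBall.measurableSet
  have hmono : Monotone s := fun m n h => Metric.closedBall_subset_closedBall (by exact_mod_cast h)
  have hU : ⋃ n, s n = Set.univ := Metric.iUnion_closedBall_nat 0
  have hlim : Tendsto (fun n => (μ : Measure Δ) (s n)) atTop (𝓝 1) := by
    have := tendsto_measure_iUnion_atTop (μ := (μ : Measure Δ)) hmono
    rwa [hU, measure_univ] at this
  obtain ⟨n₀, hn₀⟩ := ((hlim.eventually (lt_mem_nhds (by norm_num : (0 : ℝ≥0∞) < 1)))).exists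
  have hpos : ∀ n, (μ : Measure Δ) (s (n + n₀)) ≠ 0 := fun n =>
    (hn₀.trans_le (measure_mono (hmono (Nat.le_add_left _ _)))).ne'
  let ν : ℕ → ProbabilityMeasure Δ := fun n =>
    ⟨ProbabilityTheory.cond (μ : Measure Δ) (s (n + n₀)),
      ProbabilityTheory.cond_isProbabilityMeasure (hpos n)⟩
  have hlim' : Tendsto (fun n => ((μ : Measure Δ) (s (n + n₀)))⁻¹) atTop (𝓝 1) := by
    have := (hlim.comp (tendsto_add_atTop_nat n₀)).inv
    rwa [inv_one] at this
  have hν : Tendsto ν atTop (𝓝 μ) := by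
    refine ProbabilityMeasure.tendsto_iff_forall_integral_tendsto.2 fun f => ?_
    have h1 : Tendsto (fun n => ∫ x in s (n + n₀), f x ∂(μ : Measure Δ)) atTop
        (𝓝 (∫ x, f x ∂(μ : Measure Δ))) := by
      have := tendsto_setIntegral_of_monotone (μ := (μ : Measure Δ)) (f := f) hs hmono
        (f.integrable _).integrableOn
      rw [hU, setIntegral_univ] at this
      exact this.comp (tendsto_add_atTop_nat n₀)
    have h2 := ((ENNReal.tendsto_toReal ENNReal.one_ne_top).comp hlim').mul h1
    rw [ENNReal.toReal_one, one_mul] at h2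
    refine h2.congr fun n => ?_
    simp [ν, ProbabilityTheory.cond, integral_smul_measure]
  have hle : ∀ n, mutualEnergy β V C (ν n : Measure Δ) (ν n) ≤
      ((μ : Measure Δ) (s (n + n₀)))⁻¹ * (((μ : Measure Δ) (s (n + n₀)))⁻¹ *
        mutualEnergy β V C (μ : Measure Δ) μ) := by
    intro n
    have htop : ((μ : Measure Δ) (s (n + n₀)))⁻¹ ≠ ⊤ := ENNReal.inv_ne_top.2 (hpos n)
    simp only [ν, ProbabilityMeasure.coe_mk, ProbabilityTheory.cond, mutualEnergy,
      lintegral_smul_measure, smul_eq_mul]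
    rw [lintegral_const_mul' _ _ htop]
    gcongr <;> exact Measure.restrict_le_self
  have hlim2 : Tendsto (fun n => ((μ : Measure Δ) (s (n + n₀)))⁻¹ *
      (((μ : Measure Δ) (s (n + n₀)))⁻¹ * mutualEnergy β V C (μ : Measure Δ) μ)) atTop
      (𝓝 (mutualEnergy β V C (μ : Measure Δ) μ)) := by
    have h1 := ENNReal.Tendsto.mul_const (b := mutualEnergy β V C (μ : Measure Δ) μ) hlim'
      (Or.inl one_ne_zero)
    rw [one_mul] at h1
    have h2 := ENNReal.Tendsto.mul hlim' (Or.inl one_ne_zero) h1 (Or.inr ENNReal.one_ne_top)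
    rwa [one_mul] at h2
  obtain ⟨n, hn1, hn2⟩ := ((hν.eventually hO).and (hlim2.eventually (gt_mem_nhds he))).exists
  exact ⟨(n + n₀ : ℕ), ν n, hn1, (hle n).trans_lt hn2, ProbabilityTheory.ae_cond_mem (hs _)⟩

omit [MeasurableSpace Δ] [BorelSpace Δ] [SecondCountableTopology Δ] in
-- A common translation preserves `x - y`, so only the potential changes.
lemma posKernel_add_add_le (hβ : 0 < β) {η : ℝ} {x y a : Δ} (hx : V (x + a) ≤ V x + η)
    (hy : V (y + a) ≤ V y + η) :
    posKernel β V C (x + a) (y + a) ≤ posKernel β V C x y + ENNReal.ofReal η := by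
  rcases eq_or_ne x y with rfl | h
  · simp [posKernel_self hβ]
  · rw [posKernel_of_ne h, posKernel_of_ne (fun h' => h (add_right_cancel h'))]
    refine le_trans (ENNReal.ofReal_le_ofReal ?_) ENNReal.ofReal_add_le
    rw [add_sub_add_right_eq_sub]
    linarith

omit [NormedAddCommGroup Δ] [BorelSpace Δ] [SecondCountableTopology Δ] in
lemma lintegral_add_const (μ : Measure Δ) [IsProbabilityMeasure μ] (f : Δ → ℝ≥0∞) (c : ℝ≥0∞) :
    ∫⁻ x, (f x + c) ∂μ = ∫⁻ x, f x ∂μ + c := by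
  rw [lintegral_add_right _ measurable_const, lintegral_const, measure_univ, mul_one]

lemma mutualEnergy_map_add_le (hβ : 0 < β) (hV : Continuous V) {μ : Measure Δ}
    [IsProbabilityMeasure μ] {η : ℝ} {a : Δ} (h : ∀ᵐ x ∂μ, V (x + a) ≤ V x + η) :
    mutualEnergy β V C (μ.map (· + a)) (μ.map (· + a)) ≤
      mutualEnergy β V C μ μ + ENNReal.ofReal η := by
  have hm := measurable_posKernel (β := β) (C := C) hV
  have ha : Measurable fun x : Δ => x + a := measurable_add_const a
  have : IsProbabilityMeasure (μ.map (· + a)) := Measure.isProbabilityMeasure_map ha.aemeasurable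
  have hm0 : Measurable fun x => ∫⁻ y, posKernel β V C x y ∂(μ.map (· + a)) :=
    hm.lintegral_prod_right'
  rw [mutualEnergy, lintegral_map hm0 ha]
  calc ∫⁻ x, ∫⁻ y, posKernel β V C (x + a) y ∂(μ.map (· + a)) ∂μ
      ≤ ∫⁻ x, (∫⁻ y, posKernel β V C x y ∂μ + ENNReal.ofReal η) ∂μ := by
        refine lintegral_mono_ae ?_
        filter_upwards [h] with x hx
        have hmx : Measurable fun y => posKernel β V C (x + a) y := hm.comp measurable_prodMk_left
        rw [lintegral_map hmx ha]
        calc ∫⁻ y, posKernel β V C (x + a) (y + a) ∂μ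
            ≤ ∫⁻ y, (posKernel β V C x y + ENNReal.ofReal η) ∂μ := by
              refine lintegral_mono_ae ?_
              filter_upwards [h] with y hy
              exact posKernel_add_add_le hβ hx hy
          _ = _ := lintegral_add_const _ _ _
    _ = _ := lintegral_add_const _ _ _

variable [InnerProductSpace ℝ Δ]

/-- The convolution of `μ` with the image of `γ` under the homothety of ratio `δ`. -/
def mollify (μ γ : Measure Δ) (δ : ℝ) : Measure Δ := (μ.prod γ).map fun p => p.1 + δ • p.2

lemma measurable_mollify_map (δ : ℝ) : Measurable fun p : Δ × Δ => p.1 + δ • p.2 := by fun_prop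

instance (μ γ : Measure Δ) [IsProbabilityMeasure μ] [IsProbabilityMeasure γ] (δ : ℝ) :
    IsProbabilityMeasure (mollify μ γ δ) :=
  Measure.isProbabilityMeasure_map (measurable_mollify_map δ).aemeasurable

lemma mutualEnergy_mollify_left (hV : Continuous V) (μ γ κ : Measure Δ) [SFinite μ] [SFinite γ]
    [SFinite κ] (δ : ℝ) :
    mutualEnergy β V C (mollify μ γ δ) κ =
      ∫⁻ u, mutualEnergy β V C (μ.map (· + δ • u)) κ ∂γ := by
  have hm : Measurable fun x => ∫⁻ y, posKernel β V C x y ∂κ :=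
    (measurable_posKernel hV).lintegral_prod_right'
  have hm' : Measurable fun p : Δ × Δ => ∫⁻ y, posKernel β V C (p.1 + δ • p.2) y ∂κ :=
    hm.comp (measurable_mollify_map δ)
  rw [mutualEnergy, mollify, lintegral_map hm (measurable_mollify_map δ),
    lintegral_prod_symm' _ hm']
  refine lintegral_congr fun u => ?_
  rw [mutualEnergy, lintegral_map hm (measurable_add_const _)]

/-- The mollified measure is a mixture of translates of `μ`. By positive definiteness the mutual
energy of two translates is at most the mean of their own energies, each within `η` of that of `μ`.
No regularity of the singular kernel is needed. -/
lemma mutualEnergy_mollify_le [FiniteDimensional ℝ Δ] (hβ : 0 < β) (hV : Continuous V)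
    (hC : ∀ x, β / 2 * Real.log (1 + ‖x‖ ^ 2) ≤ V x + C)
    {μ γ : Measure Δ} [IsProbabilityMeasure μ] [IsProbabilityMeasure γ] {η δ : ℝ}
    (h : ∀ᵐ u ∂γ, ∀ᵐ x ∂μ, V (x + δ • u) ≤ V x + η) :
    mutualEnergy β V C (mollify μ γ δ) (mollify μ γ δ) ≤
      mutualEnergy β V C μ μ + ENNReal.ofReal η := by
  have hprob : ∀ a : Δ, IsProbabilityMeasure (μ.map (· + a)) := fun a =>
    Measure.isProbabilityMeasure_map (measurable_add_const a).aemeasurable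
  have hpair : ∀ᵐ u ∂γ, ∀ᵐ v ∂γ,
      mutualEnergy β V C (μ.map (· + δ • v)) (μ.map (· + δ • u)) ≤
        mutualEnergy β V C μ μ + ENNReal.ofReal η := by
    filter_upwards [h] with u hu
    filter_upwards [h] with v hv
    have h1 := two_mul_mutualEnergy_le hβ hV hC (μ.map (· + δ • v)) (μ.map (· + δ • u))
    have h2 := h1.trans (add_le_add (mutualEnergy_map_add_le hβ hV hv)
      (mutualEnergy_map_add_le hβ hV hu))
    rw [← two_mul] at h2
    exact (ENNReal.mul_le_mul_iff_right (by simp) (by simp)).1 h2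
  rw [mutualEnergy_mollify_left hV]
  calc ∫⁻ u, mutualEnergy β V C (μ.map (· + δ • u)) (mollify μ γ δ) ∂γ
      ≤ ∫⁻ _, (mutualEnergy β V C μ μ + ENNReal.ofReal η) ∂γ := by
        refine lintegral_mono_ae ?_
        filter_upwards [hpair] with u hu
        rw [mutualEnergy_comm hV, mutualEnergy_mollify_left hV]
        calc _ ≤ ∫⁻ _, (mutualEnergy β V C μ μ + ENNReal.ofReal η) ∂γ := lintegral_mono_ae hu
          _ = _ := by simp
    _ = _ := by simp

lemma tendsto_mollify (μ γ : ProbabilityMeasure Δ) {δ : ℕ → ℝ} (hδ : Tendsto δ atTop (𝓝 0)) :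
    Tendsto (β := ProbabilityMeasure Δ) (fun n => ⟨mollify (μ : Measure Δ) γ (δ n), inferInstance⟩)
      atTop (𝓝 μ) := by
  refine ProbabilityMeasure.tendsto_iff_forall_integral_tendsto.2 fun f => ?_
  have h1 : ∀ n, ∫ x, f x ∂(mollify (μ : Measure Δ) γ (δ n)) =
      ∫ p : Δ × Δ, f (p.1 + δ n • p.2) ∂((μ : Measure Δ).prod (γ : Measure Δ)) := fun n =>
    integral_map (measurable_mollify_map _).aemeasurable
      f.continuous.measurable.aestronglyMeasurable
  have h2 : ∫ x, f x ∂(μ : Measure Δ) =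
      ∫ p : Δ × Δ, f p.1 ∂((μ : Measure Δ).prod (γ : Measure Δ)) := by
    rw [integral_fun_fst]
    simp
  simp only [ProbabilityMeasure.coe_mk, h1, h2]
  refine tendsto_integral_of_dominated_convergence (fun _ => ‖f‖) (fun n => ?_)
    (integrable_const _) (fun n => Eventually.of_forall fun p => f.norm_coe_le_norm _)
    (Eventually.of_forall fun p => ?_)
  · exact (f.continuous.measurable.comp (measurable_mollify_map _)).aestronglyMeasurable
  · refine (f.continuous.tendsto _).comp ?_
    have := (tendsto_const_nhds (x := p.1)).add (hδ.smul_const p.2)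
    simpa using this

end Approximation

/-! ### The lower bound for arbitrary open sets. -/

section LowerBound

variable {Δ : Type} [NormedAddCommGroup Δ] [InnerProductSpace ℝ Δ] [FiniteDimensional ℝ Δ]
  [MeasureSpace Δ] [BorelSpace Δ] [(volume : Measure Δ).IsAddHaarMeasure]
  {β : ℝ} {V : Δ → ℝ} {C : ℝ}

/-- The uniform distribution on the unit ball. -/
def uniformBall (Δ : Type) [NormedAddCommGroup Δ] [MeasureSpace Δ] : Measure Δ :=
  ProbabilityTheory.cond volume (Metric.closedBall 0 1)

instance isProbabilityMeasure_uniformBall : IsProbabilityMeasure (uniformBall Δ) :=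
  ProbabilityTheory.cond_isProbabilityMeasure_of_finite
    (Metric.measure_closedBall_pos _ _ one_pos).ne' measure_closedBall_lt_top.ne

/-- The uniform law on a ball of radius `δ` has bounded density, and averaging its translates
preserves the bound. -/
lemma exists_mollify_le_smul (μ : Measure Δ) [IsProbabilityMeasure μ] {δ : ℝ} (hδ : 0 < δ) :
    ∃ c : ℝ, 0 < c ∧ mollify μ (uniformBall Δ) δ ≤ ENNReal.ofReal c • volume := by
  set B := (volume : Measure Δ) (Metric.closedBall 0 1) with hB
  have hB0 : B ≠ 0 := (Metric.measure_closedBall_pos _ _ one_pos).ne'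
  have hBtop : B ≠ ⊤ := measure_closedBall_lt_top.ne
  set d := Module.finrank ℝ Δ
  refine ⟨B.toReal⁻¹ * |(δ ^ d)⁻¹|, ?_, Measure.le_iff.2 fun s hs => ?_⟩
  · have := ENNReal.toReal_pos hB0 hBtop
    positivity
  · have h1 : ∀ x : Δ, uniformBall Δ {u | x + δ • u ∈ s} ≤
        ENNReal.ofReal (B.toReal⁻¹ * |(δ ^ d)⁻¹|) * volume s := by
      intro x
      have h2 : {u : Δ | x + δ • u ∈ s} = (δ • ·) ⁻¹' ((x + ·) ⁻¹' s) := rfl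
      rw [uniformBall, ProbabilityTheory.cond_apply Metric.isClosed_closedBall.measurableSet,
        ENNReal.ofReal_mul (by positivity), ENNReal.ofReal_inv_of_pos (ENNReal.toReal_pos hB0 hBtop),
        ENNReal.ofReal_toReal hBtop, mul_assoc]
      gcongr
      refine (measure_mono Set.inter_subset_right).trans ?_
      rw [h2, Measure.addHaar_preimage_smul _ hδ.ne', measure_preimage_add]
    rw [mollify, Measure.map_apply (measurable_mollify_map δ) hs,
      Measure.prod_apply (measurable_mollify_map δ hs)]
    calc _ ≤ ∫⁻ _, ENNReal.ofReal (B.toReal⁻¹ * |(δ ^ d)⁻¹|) * volume s ∂μ :=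
          lintegral_mono h1
      _ = _ := by simp

/-- Nice measures are dense in energy. -/
lemma exists_nice_mem (hβ : 0 < β) (hV : Continuous V)
    (hC : ∀ x, β / 2 * Real.log (1 + ‖x‖ ^ 2) ≤ V x + C) {μ : ProbabilityMeasure Δ}
    {O : Set (ProbabilityMeasure Δ)} (hO : IsOpen O) (hμ : μ ∈ O) {e : ℝ≥0∞}
    (he : mutualEnergy β V C (μ : Measure Δ) μ < e) :
    ∃ ν ∈ O, mutualEnergy β V C (ν : Measure Δ) ν < e ∧
      (∃ c : ℝ, 0 < c ∧ (ν : Measure Δ) ≤ ENNReal.ofReal c • volume) ∧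
      ∃ B : ℝ, ∀ᵐ x ∂(ν : Measure Δ), V x ≤ B := by
  obtain ⟨R, μ', hμ', he', hR⟩ := exists_bounded_mem (hO.mem_nhds hμ) he
  obtain ⟨η, hη, hηe⟩ : ∃ η : ℝ, 0 < η ∧
      mutualEnergy β V C (μ' : Measure Δ) μ' + ENNReal.ofReal η < e := by
    obtain ⟨r, hr, hr'⟩ := ENNReal.lt_iff_exists_add_pos_lt.1 he'
    exact ⟨r, hr, by simpa using hr'⟩
  -- Since `‖δ • u‖ ≤ 1`, the mollified measure lives in the ball of radius `R + 1`, where `V` is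
  -- bounded and uniformly continuous.
  have hK : IsCompact (Metric.closedBall (0 : Δ) (R + 1)) := isCompact_closedBall _ _
  obtain ⟨B, hB⟩ := hK.bddAbove_image hV.continuousOn
  obtain ⟨ε, hε, huc⟩ := Metric.uniformContinuousOn_iff.1
    (hK.uniformContinuousOn_of_continuous hV.continuousOn) η hη
  have hball : ∀ᵐ u ∂(uniformBall Δ), ‖u‖ ≤ 1 := by
    filter_upwards [ProbabilityTheory.ae_cond_mem
      (μ := (volume : Measure Δ)) (Metric.isClosed_closedBall (x := (0 : Δ)) (ε := 1)).measurableSet]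
      with u hu
    simpa using hu
  have hδlim : Tendsto (fun n : ℕ => 1 / ((n : ℝ) + 1)) atTop (𝓝 0) :=
    tendsto_one_div_add_atTop_nhds_zero_nat
  obtain ⟨n, hnO, hnε⟩ := (((tendsto_mollify μ' ⟨uniformBall Δ, inferInstance⟩ hδlim).eventually
    (hO.mem_nhds hμ')).and (hδlim.eventually (gt_mem_nhds hε))).exists
  set δ := 1 / ((n : ℝ) + 1) with hδ
  have hδ0 : 0 < δ := by positivity
  have hδ1 : δ ≤ 1 := by
    rw [hδ, div_le_one (by positivity)]
    linarith [(Nat.cast_nonneg n : (0 : ℝ) ≤ n)]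
  have hmem : ∀ x ∈ Metric.closedBall (0 : Δ) R, ∀ u : Δ, ‖u‖ ≤ 1 →
      x + δ • u ∈ Metric.closedBall (0 : Δ) (R + 1) := by
    intro x hx u hu
    rw [mem_closedBall_zero_iff] at hx ⊢
    calc ‖x + δ • u‖ ≤ ‖x‖ + ‖δ • u‖ := norm_add_le _ _
      _ ≤ R + 1 := by
        rw [norm_smul, Real.norm_of_nonneg hδ0.le]
        exact add_le_add hx (mul_le_one₀ hδ1 (norm_nonneg u) hu)
  refine ⟨_, hnO, ?_, exists_mollify_le_smul _ hδ0, B, ?_⟩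
  · refine (mutualEnergy_mollify_le (γ := uniformBall Δ) hβ hV hC ?_).trans_lt hηe
    filter_upwards [hball] with u hu
    filter_upwards [hR] with x hx
    have h1 := huc _ (hmem x hx u hu) x
      (Metric.closedBall_subset_closedBall (by linarith) hx) (by
        rw [dist_eq_norm, add_sub_cancel_left, norm_smul, Real.norm_of_nonneg hδ0.le]
        exact (mul_le_of_le_one_right hδ0.le hu).trans_lt hnε)
    rw [Real.dist_eq] at h1
    linarith [(abs_lt.1 h1).2]
  · change ∀ᵐ x ∂(Measure.map _ _), V x ≤ B
    have hms : MeasurableSet {x : Δ | V x ≤ B} := measurableSet_le hV.measurable measurable_const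
    rw [ae_map_iff (measurable_mollify_map δ).aemeasurable hms]
    have h1 : ∀ᵐ p ∂((μ' : Measure Δ).prod (uniformBall Δ)), p.1 ∈ Metric.closedBall (0 : Δ) R :=
      Measure.quasiMeasurePreserving_fst.ae hR
    have h2 : ∀ᵐ p ∂((μ' : Measure Δ).prod (uniformBall Δ)), ‖p.2‖ ≤ 1 :=
      Measure.quasiMeasurePreserving_snd.ae hball
    filter_upwards [h1, h2] with p hp1 hp2
    exact hB ⟨_, hmem _ hp1 _ hp2, rfl⟩

/-- The large deviation lower bound for the unnormalized measures. -/
lemma eventually_le_setLIntegral_density_of_isOpen (hβ : 0 < β)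
    (hV : Continuous V) (hC : ∀ x, β / 2 * Real.log (1 + ‖x‖ ^ 2) ≤ V x + C)
    {O : Set (ProbabilityMeasure Δ)} (hO : IsOpen O) {μ : ProbabilityMeasure Δ} (hμ : μ ∈ O) {b : ℝ}
    (hb : energy β V μ < b) :
    ∀ᶠ N : ℕ in atTop, ENNReal.ofReal (Real.exp (-(b * (N : ℝ) ^ 2))) ≤
      ∫⁻ x in empiricalEvent O N, ENNReal.ofReal (density β V N x) := by
  obtain ⟨a, ha, hab⟩ : ∃ a : ℝ, energy β V μ < a ∧ a < b := by
    obtain ⟨a, ha, hab⟩ := EReal.lt_iff_exists_real_btwn.1 hb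
    exact ⟨a, ha, by exact_mod_cast hab⟩
  rw [energy_eq hβ hV hC] at ha
  have he : mutualEnergy β V C (μ : Measure Δ) μ < ENNReal.ofReal (a + C) := by
    rw [EReal.sub_lt_iff (by simp) (by simp), ← EReal.coe_add] at ha
    rw [← EReal.coe_ennreal_lt_coe_ennreal_iff, EReal.coe_ennreal_ofReal]
    exact ha.trans_le (by exact_mod_cast le_max_left _ _)
  obtain ⟨ν, hνO, hνe, ⟨c, hc, hνc⟩, B, hB⟩ := exists_nice_mem hβ hV hC hO hμ he
  exact eventually_le_setLIntegral_density_of_le_smul hβ hV hC (hO.mem_nhds hνO) hc hνc hB hνe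
    (by linarith)

end LowerBound

end CoulombGas

namespace CoulombGas

/-! ### A global form of the growth condition. -/

section Growth

variable {Δ : Type} [NormedAddCommGroup Δ] [ProperSpace Δ] {β β' : ℝ} {V : Δ → ℝ}

/-- Far away `log (1 + ‖x‖ ^ 2) ≤ log 2 + 2 * log ‖x‖`, valid once `‖x‖ ≥ 1`; on the remaining ball,
compactness supplies the constant. -/
lemma Admissible.exists_growth (h : Admissible β β' V) :
    ∃ C : ℝ, ∀ x, β' / 2 * Real.log (1 + ‖x‖ ^ 2) ≤ V x + C := by
  have hβ' : 0 < β' := one_pos.trans h.one_lt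
  obtain ⟨c, -, hc⟩ := EReal.lt_iff_exists_real_btwn.1 h.growth
  have hev := eventually_lt_of_lt_liminf hc
  obtain ⟨R, -, hR⟩ := (hasBasis_cobounded_norm (E := Δ)).eventually_iff.1 hev
  have hcont : Continuous fun x : Δ => β' / 2 * Real.log (1 + ‖x‖ ^ 2) - V x :=
    (continuous_const.mul ((by fun_prop : Continuous fun x : Δ => 1 + ‖x‖ ^ 2).log
      fun x => by positivity)).sub h.continuous
  obtain ⟨B, hB⟩ := (isCompact_closedBall (0 : Δ) (max R 1)).bddAbove_image hcont.continuousOn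
  refine ⟨max B (β' / 2 * Real.log 2 - c), fun x => ?_⟩
  rcases le_or_gt ‖x‖ (max R 1) with hx | hx
  · have h1 := hB ⟨x, mem_closedBall_zero_iff.2 hx, rfl⟩
    simp only at h1
    linarith [le_max_left B (β' / 2 * Real.log 2 - c)]
  · have hxR : R ≤ ‖x‖ := (le_max_left _ _).trans hx.le
    have hx1 : 1 ≤ ‖x‖ := (le_max_right _ _).trans hx.le
    have h1 : c < V x - β' * Real.log ‖x‖ := by exact_mod_cast hR hxR
    have h2 : Real.log (1 + ‖x‖ ^ 2) ≤ Real.log 2 + 2 * Real.log ‖x‖ := by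
      have h3 : Real.log (2 * ‖x‖ ^ 2) = Real.log 2 + 2 * Real.log ‖x‖ := by
        rw [Real.log_mul (by norm_num) (by positivity), Real.log_pow]
        norm_num
      rw [← h3]
      exact Real.log_le_log (by positivity) (by nlinarith)
    have h4 := mul_le_mul_of_nonneg_left h2 (by positivity : 0 ≤ β' / 2)
    linarith [le_max_right B (β' / 2 * Real.log 2 - c)]

omit [ProperSpace Δ] in
lemma growth_of_le (hle : β ≤ β') {C : ℝ} (hC : ∀ x, β' / 2 * Real.log (1 + ‖x‖ ^ 2) ≤ V x + C)
    (x : Δ) : β / 2 * Real.log (1 + ‖x‖ ^ 2) ≤ V x + C := by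
  refine le_trans ?_ (hC x)
  have : 0 ≤ Real.log (1 + ‖x‖ ^ 2) := Real.log_nonneg (by nlinarith [sq_nonneg ‖x‖])
  gcongr

end Growth

/-! ### Finiteness of the partition functions. -/

section PartitionFunction

variable {Δ : Type} [NormedAddCommGroup Δ] {β β' : ℝ} {V : Δ → ℝ} {C : ℝ}

/-- Replacing `‖x - y‖ ^ 2` by `(1 + ‖x‖ ^ 2) * (1 + ‖y‖ ^ 2)` decouples the particles: each gains
`N * β'` in decay from its potential and loses `β` in each of its `N - 1` pairs. -/
lemma density_le_prod (hβ : 0 < β) (hC : ∀ x, β' / 2 * Real.log (1 + ‖x‖ ^ 2) ≤ V x + C) (N : ℕ)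
    (x : Fin N → Δ) :
    density β V N x ≤ ∏ i, (Real.exp (N * C) *
      (1 + ‖x i‖ ^ 2) ^ (-(N * β' - (N - 1) * β) / 2)) := by
  have h1 : ∏ i, ∏ j ∈ Finset.Ioi i, ‖x i - x j‖ ^ β ≤
      Real.exp (∑ i, ∑ j ∈ Finset.Ioi i, (β / 2 * Real.log (1 + ‖x i‖ ^ 2) +
        β / 2 * Real.log (1 + ‖x j‖ ^ 2))) := by
    simp only [Real.exp_sum]
    refine Finset.prod_le_prod (fun i _ => Finset.prod_nonneg fun j _ => by positivity) fun i _ =>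
      Finset.prod_le_prod (fun j _ => by positivity) fun j _ => ?_
    calc ‖x i - x j‖ ^ β = (‖x i - x j‖ ^ 2) ^ (β / 2) := by
          rw [← Real.rpow_natCast_mul (norm_nonneg _)]
          congr 1
          push_cast
          ring
      _ ≤ ((1 + ‖x i‖ ^ 2) * (1 + ‖x j‖ ^ 2)) ^ (β / 2) := by
          gcongr
          exact norm_sub_sq_le _ _
      _ = _ := by
          rw [Real.rpow_def_of_pos (by positivity), Real.log_mul (by positivity) (by positivity)]
          congr 1
          ring
  rw [density]
  calc _ ≤ Real.exp ((N - 1) * ∑ i, β / 2 * Real.log (1 + ‖x i‖ ^ 2)) *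
        ∏ i : Fin N, Real.exp (N * C - N * (β' / 2 * Real.log (1 + ‖x i‖ ^ 2))) := by
        rw [← sum_Ioi_add]
        refine mul_le_mul h1 (Finset.prod_le_prod (fun i _ => Real.exp_nonneg _) fun i _ => ?_)
          (Finset.prod_nonneg fun i _ => Real.exp_nonneg _) (Real.exp_nonneg _)
        refine Real.exp_le_exp.2 ?_
        have := mul_le_mul_of_nonneg_left (hC (x i)) (Nat.cast_nonneg (α := ℝ) N)
        linarith
    _ = _ := by
        rw [Finset.mul_sum, Real.exp_sum, ← Finset.prod_mul_distrib]
        refine Finset.prod_congr rfl fun i _ => ?_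
        rw [Real.rpow_def_of_pos (by positivity), ← Real.exp_add, ← Real.exp_add]
        congr 1
        ring

variable [InnerProductSpace ℝ Δ] [FiniteDimensional ℝ Δ]
  [MeasureSpace Δ] [BorelSpace Δ] [(volume : Measure Δ).IsAddHaarMeasure]

lemma partitionFunction_lt_top (hβ : 0 < β)
    (hC : ∀ x, β' / 2 * Real.log (1 + ‖x‖ ^ 2) ≤ V x + C) (N : ℕ)
    (hN : N ≠ 0 → (Module.finrank ℝ Δ : ℝ) < N * β' - (N - 1) * β) :
    partitionFunction β V N < ⊤ := by
  have hint : Integrable (fun x : Fin N → Δ => ∏ i, (Real.exp (N * C) *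
      (1 + ‖x i‖ ^ 2) ^ (-(N * β' - (N - 1) * β) / 2))) volume := by
    refine Integrable.fintype_prod (f := fun (_ : Fin N) (y : Δ) => Real.exp (N * C) *
      (1 + ‖y‖ ^ 2) ^ (-(N * β' - (N - 1) * β) / 2)) fun i => ?_
    have hN0 : N ≠ 0 := by have := i.2; omega
    exact (integrable_rpow_neg_one_add_norm_sq (hN hN0)).const_mul _
  calc partitionFunction β V N
      ≤ ∫⁻ x : Fin N → Δ, ENNReal.ofReal (∏ i, (Real.exp (N * C) *
        (1 + ‖x i‖ ^ 2) ^ (-(N * β' - (N - 1) * β) / 2))) :=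
        lintegral_mono fun x => ENNReal.ofReal_le_ofReal (density_le_prod hβ hC N x)
    _ < ⊤ := hint.lintegral_lt_top

end PartitionFunction

/-! ### A measure of finite energy. -/

section FiniteEnergy

lemma lintegral_neg_log_abs_lt_top :
    ∫⁻ u in Set.Icc (-1 : ℝ) 1, ENNReal.ofReal (-Real.log |u|) < ⊤ := by
  have h : IntervalIntegrable (fun u => -Real.log |u|) volume (-1 : ℝ) 1 := by
    simp only [Real.log_abs]
    exact intervalIntegral.intervalIntegrable_log'.neg
  rw [intervalIntegrable_iff_integrableOn_Icc_of_le (by norm_num)] at h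
  exact h.lintegral_lt_top

lemma lintegral_neg_log_abs_sub_le {s : ℝ} (hs : s ∈ Set.Icc (0 : ℝ) 1) :
    ∫⁻ t in Set.Icc (0 : ℝ) 1, ENNReal.ofReal (-Real.log |s - t|) ≤
      ∫⁻ u in Set.Icc (-1 : ℝ) 1, ENNReal.ofReal (-Real.log |u|) := by
  rw [← lintegral_indicator measurableSet_Icc, ← lintegral_indicator measurableSet_Icc,
    ← lintegral_sub_left_eq_self ((Set.Icc (-1 : ℝ) 1).indicator _) s]
  refine lintegral_mono fun t => ?_
  by_cases ht : t ∈ Set.Icc (0 : ℝ) 1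
  · have hst : s - t ∈ Set.Icc (-1 : ℝ) 1 :=
      ⟨by linarith [hs.1, ht.2], by linarith [hs.2, ht.1]⟩
    rw [Set.indicator_of_mem ht, Set.indicator_of_mem hst]
  · rw [Set.indicator_of_notMem ht]
    exact zero_le

variable {Δ : Type} [NormedAddCommGroup Δ] [InnerProductSpace ℝ Δ] [Nontrivial Δ]
  [MeasurableSpace Δ] [BorelSpace Δ] [SecondCountableTopology Δ] {β : ℝ} {V : Δ → ℝ} {C : ℝ}

/-- The uniform distribution on a segment has finite logarithmic energy. -/
lemma exists_mutualEnergy_ne_top (hβ : 0 < β) (hV : Continuous V) :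
    ∃ μ : ProbabilityMeasure Δ, mutualEnergy β V C (μ : Measure Δ) μ ≠ ⊤ := by
  -- The singularity is integrable along a line already, so a segment in a unit direction serves
  -- every dimension.
  obtain ⟨e, he⟩ := exists_norm_eq Δ zero_le_one
  have hcont : Continuous fun t : ℝ => t • e := by fun_prop
  have hm : Measurable fun t : ℝ => t • e := hcont.measurable
  let lam : Measure ℝ := volume.restrict (Set.Icc 0 1)
  have hlam : IsProbabilityMeasure lam := ⟨by simp [lam]⟩
  obtain ⟨B, hB⟩ := (isCompact_Icc (a := (0 : ℝ)) (b := 1)).bddAbove_image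
    (hV.comp hcont).continuousOn
  have hB' : ∀ t ∈ Set.Icc (0 : ℝ) 1, V (t • e) ≤ B := fun t ht => hB ⟨t, ht, rfl⟩
  refine ⟨⟨lam.map fun t => t • e, Measure.isProbabilityMeasure_map hm.aemeasurable⟩, ?_⟩
  have hpk := measurable_posKernel (β := β) (C := C) hV
  set K := ∫⁻ u in Set.Icc (-1 : ℝ) 1, ENNReal.ofReal (-Real.log |u|) with hK
  have hKtop : K < ⊤ := lintegral_neg_log_abs_lt_top
  have hinner : ∀ s ∈ Set.Icc (0 : ℝ) 1, ∫⁻ t, posKernel β V C (s • e) (t • e) ∂lam ≤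
      ENNReal.ofReal (β / 2) * K + ENNReal.ofReal (B + C) := by
    intro s hs
    have hne : ∀ᵐ t ∂lam, t ≠ s := ae_restrict_of_ae (Measure.ae_ne volume s)
    have hmem : ∀ᵐ t ∂lam, t ∈ Set.Icc (0 : ℝ) 1 := ae_restrict_mem measurableSet_Icc
    calc ∫⁻ t, posKernel β V C (s • e) (t • e) ∂lam
        ≤ ∫⁻ t, (ENNReal.ofReal (β / 2) * ENNReal.ofReal (-Real.log |s - t|) +
            ENNReal.ofReal (B + C)) ∂lam := by
          refine lintegral_mono_ae ?_
          filter_upwards [hne, hmem] with t ht htm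
          have he0 : e ≠ 0 := by rintro rfl; simp at he
          rw [posKernel_of_ne (fun h => ht (smul_left_injective ℝ he0 h).symm),
            ← ENNReal.ofReal_mul (by positivity), ← sub_smul, norm_smul, he, mul_one,
            Real.norm_eq_abs]
          refine le_trans (ENNReal.ofReal_le_ofReal ?_) ENNReal.ofReal_add_le
          linarith [hB' s hs, hB' t htm]
      _ = ENNReal.ofReal (β / 2) * ∫⁻ t, ENNReal.ofReal (-Real.log |s - t|) ∂lam +
            ENNReal.ofReal (B + C) := by
          rw [lintegral_add_right _ measurable_const, lintegral_const_mul' _ _ (by simp)]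
          simp
      _ ≤ _ := by
          gcongr
          exact lintegral_neg_log_abs_sub_le hs
  have h1 : Measurable fun x => ∫⁻ y, posKernel β V C x y ∂(lam.map fun t => t • e) :=
    hpk.lintegral_prod_right'
  have h2 : ∀ x, Measurable fun y => posKernel β V C x y := fun x =>
    hpk.comp measurable_prodMk_left
  refine ne_of_lt ?_
  rw [ProbabilityMeasure.coe_mk, mutualEnergy, lintegral_map h1 hm]
  calc _ ≤ ∫⁻ _, (ENNReal.ofReal (β / 2) * K + ENNReal.ofReal (B + C)) ∂lam := by
        refine lintegral_mono_ae ?_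
        filter_upwards [ae_restrict_mem (μ := (volume : Measure ℝ)) measurableSet_Icc] with s hs
        rw [lintegral_map (h2 _) hm]
        exact hinner s hs
    _ < ⊤ := by
        rw [lintegral_const, measure_univ, mul_one]
        exact ENNReal.add_lt_top.2
          ⟨ENNReal.mul_lt_top ENNReal.ofReal_lt_top hKtop, ENNReal.ofReal_lt_top⟩

end FiniteEnergy

/-! ### Compact sublevel sets and the minimizer. -/

section Minimizer

variable {Δ : Type} [NormedAddCommGroup Δ] [InnerProductSpace ℝ Δ] [FiniteDimensional ℝ Δ]
  [MeasurableSpace Δ] [BorelSpace Δ] {β : ℝ} {V : Δ → ℝ} {C : ℝ}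
  (hβ : 0 < β) (hV : Continuous V) (hC : ∀ x, β / 2 * Real.log (1 + ‖x‖ ^ 2) ≤ V x + C)
include hβ hV hC

lemma energy_le_energy_iff (μ ν : ProbabilityMeasure Δ) : energy β V μ ≤ energy β V ν ↔
    mutualEnergy β V C (μ : Measure Δ) μ ≤ mutualEnergy β V C (ν : Measure Δ) ν := by
  rw [energy_eq hβ hV hC, energy_eq hβ hV hC, ← EReal.coe_ennreal_le_coe_ennreal_iff]
  refine ⟨fun h => ?_, fun h => EReal.sub_le_sub h le_rfl⟩
  have := add_le_add_left h (C : EReal)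
  simpa [EReal.sub_add_cancel] using this

lemma isCompact_setOf_energy_le (α : ℝ) :
    IsCompact {μ : ProbabilityMeasure Δ | energy β V μ ≤ (α : EReal)} := by
  have h := isCompact_setOf_lintegral_le (continuous_posKernel (β := β) (C := C) hV)
    (blowsUpAtInfinity_posKernel hβ hC) (ENNReal.ofReal_ne_top (r := α + C))
  rcases le_or_gt 0 (α + C) with hα | hα
  · convert h using 3 with μ
    rw [energy_eq hβ hV hC, ← mutualEnergy_eq_lintegral_prod hV,
      ← EReal.coe_ennreal_le_coe_ennreal_iff, EReal.coe_ennreal_ofReal, max_eq_left hα,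
      EReal.sub_le_iff_le_add (by simp) (by simp), EReal.coe_add]
  · convert isCompact_empty
    refine Set.eq_empty_of_forall_notMem fun μ hμ => ?_
    rw [Set.mem_ofPred_eq, energy_eq hβ hV hC, EReal.sub_le_iff_le_add (by simp) (by simp),
      ← EReal.coe_add] at hμ
    have h0 : (0 : EReal) ≤ ((α + C : ℝ) : EReal) := (EReal.coe_ennreal_nonneg _).trans hμ
    exact absurd (by exact_mod_cast h0) (not_le.2 hα)

lemma exists_isMinimizer [Nontrivial Δ] : ∃ μ : ProbabilityMeasure Δ, IsMinimizer β V μ ∧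
    (∀ ν : ProbabilityMeasure Δ, IsMinimizer β V ν → ν = μ) ∧
    mutualEnergy β V C (μ : Measure Δ) μ ≠ ⊤ := by
  obtain ⟨μ₀, hμ₀⟩ := exists_mutualEnergy_ne_top (Δ := Δ) (C := C) hβ hV
  rw [mutualEnergy_eq_lintegral_prod hV] at hμ₀
  obtain ⟨μ, hμ⟩ := exists_forall_lintegral_le (continuous_posKernel (β := β) (C := C) hV)
    (blowsUpAtInfinity_posKernel hβ hC) hμ₀
  have hμ' : ∀ ν : ProbabilityMeasure Δ,
      mutualEnergy β V C (μ : Measure Δ) μ ≤ mutualEnergy β V C (ν : Measure Δ) ν := fun ν => by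
    rw [mutualEnergy_eq_lintegral_prod hV, mutualEnergy_eq_lintegral_prod hV]
    exact hμ ν
  have hfin : mutualEnergy β V C (μ : Measure Δ) μ ≠ ⊤ := by
    rw [mutualEnergy_eq_lintegral_prod hV]
    exact ne_top_of_le_ne_top hμ₀ (hμ μ₀)
  refine ⟨μ, fun ν => (energy_le_energy_iff hβ hV hC μ ν).2 (hμ' ν), fun ν hν => ?_, hfin⟩
  exact (eq_of_forall_mutualEnergy_le hβ hV hC hfin hμ'
    fun ρ => (energy_le_energy_iff hβ hV hC ν ρ).1 (hν ρ)).symm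

lemma exists_energy_eq_coe {μ : ProbabilityMeasure Δ}
    (hμ : mutualEnergy β V C (μ : Measure Δ) μ ≠ ⊤) : ∃ c : ℝ, energy β V μ = (c : EReal) := by
  refine ⟨(mutualEnergy β V C (μ : Measure Δ) μ).toReal - C, ?_⟩
  rw [energy_eq hβ hV hC, EReal.coe_sub, EReal.coe_ennreal_toReal hμ]

end Minimizer

/-! ### Normalization and the large deviation principle. -/

section LDP

lemma inv_sq_mul_log_le {N : ℕ} (hN : N ≠ 0) {p : ℝ≥0∞} {a : ℝ}
    (h : p ≤ ENNReal.ofReal (Real.exp (-(a * (N : ℝ) ^ 2)))) :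
    (((1 / (N : ℝ) ^ 2 : ℝ)) : EReal) * ENNReal.log p ≤ ((-a : ℝ) : EReal) := by
  have hN' : (N : ℝ) ≠ 0 := by exact_mod_cast hN
  have h1 := ENNReal.log_le_log h
  rw [ENNReal.log_ofReal_of_pos (Real.exp_pos _), Real.log_exp] at h1
  calc _ ≤ (((1 / (N : ℝ) ^ 2 : ℝ)) : EReal) * ((-(a * (N : ℝ) ^ 2) : ℝ) : EReal) := by
        gcongr
    _ = _ := by
        rw [← EReal.coe_mul]
        congr 1
        field_simp

lemma le_inv_sq_mul_log {N : ℕ} (hN : N ≠ 0) {p : ℝ≥0∞} {a : ℝ}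
    (h : ENNReal.ofReal (Real.exp (-(a * (N : ℝ) ^ 2))) ≤ p) :
    ((-a : ℝ) : EReal) ≤ (((1 / (N : ℝ) ^ 2 : ℝ)) : EReal) * ENNReal.log p := by
  have hN' : (N : ℝ) ≠ 0 := by exact_mod_cast hN
  have h1 := ENNReal.log_le_log h
  rw [ENNReal.log_ofReal_of_pos (Real.exp_pos _), Real.log_exp] at h1
  calc _ = (((1 / (N : ℝ) ^ 2 : ℝ)) : EReal) * ((-(a * (N : ℝ) ^ 2) : ℝ) : EReal) := by
        rw [← EReal.coe_mul]
        congr 1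
        field_simp
    _ ≤ _ := by
        gcongr

variable {Δ : Type} [NormedAddCommGroup Δ] [InnerProductSpace ℝ Δ] [FiniteDimensional ℝ Δ]
  [MeasureSpace Δ] [BorelSpace Δ] [(volume : Measure Δ).IsAddHaarMeasure]
  {β : ℝ} {V : Δ → ℝ} {C : ℝ}

omit [BorelSpace Δ] in
lemma gasLaw_apply (N : ℕ) (A : Set (Fin N → Δ)) : gasLaw β V N A =
    (partitionFunction β V N)⁻¹ * ∫⁻ x in A, ENNReal.ofReal (density β V N x) := by
  rw [gasLaw, Measure.smul_apply, withDensity_apply', smul_eq_mul]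

lemma ofReal_exp_inv (t : ℝ) :
    (ENNReal.ofReal (Real.exp t))⁻¹ = ENNReal.ofReal (Real.exp (-t)) := by
  rw [Real.exp_neg, ENNReal.ofReal_inv_of_pos (Real.exp_pos t)]

omit [InnerProductSpace ℝ Δ] [FiniteDimensional ℝ Δ] [BorelSpace Δ] [(volume : Measure Δ).IsAddHaarMeasure] in
lemma setLIntegral_empiricalEvent_univ {N : ℕ} (hN : N ≠ 0) :
    ∫⁻ x in empiricalEvent (Set.univ : Set (ProbabilityMeasure Δ)) N,
      ENNReal.ofReal (density β V N x) = partitionFunction β V N := by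
  rw [empiricalEvent_univ hN, setLIntegral_univ, partitionFunction]

/-- The large deviation principle for the empirical measures. -/
lemma empiricalLDP_gasLaw (hβ : 0 < β) (hV : Continuous V)
    (hC : ∀ x, β / 2 * Real.log (1 + ‖x‖ ^ 2) ≤ V x + C)
    (hZ : ∀ᶠ N in atTop, partitionFunction β V N < ⊤) {μstar : ProbabilityMeasure Δ}
    (hmin : IsMinimizer β V μstar) {c : ℝ} (hc : energy β V μstar = (c : EReal)) :
    EmpiricalLDP (gasLaw β V) (fun μ => energy β V μ - energy β V μstar) := by
  -- The two unnormalized bounds for the whole space show that `Z_N` is `exp (-c * N ^ 2)` up to an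
  -- arbitrarily small error in the rate.
  have hZle : ∀ ε : ℝ, 0 < ε → ∀ᶠ N : ℕ in atTop,
      partitionFunction β V N ≤ ENNReal.ofReal (Real.exp (-((c - ε) * (N : ℝ) ^ 2))) := by
    intro ε hε
    have h := eventually_setLIntegral_density_le_of_isClosed hβ hV hC hZ
      (isClosed_univ (X := ProbabilityMeasure Δ)) (a := c - ε) (b := c - ε / 2) (by linarith)
      fun μ _ => lt_of_lt_of_le (by exact_mod_cast (by linarith)) (hc ▸ hmin μ)
    filter_upwards [h, eventually_ne_atTop 0] with N h1 hN
    rwa [setLIntegral_empiricalEvent_univ hN] at h1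
  have hZge : ∀ ε : ℝ, 0 < ε → ∀ᶠ N : ℕ in atTop,
      ENNReal.ofReal (Real.exp (-((c + ε) * (N : ℝ) ^ 2))) ≤ partitionFunction β V N := by
    intro ε hε
    have h := eventually_le_setLIntegral_density_of_isOpen hβ hV hC isOpen_univ
      (Set.mem_univ μstar) (b := c + ε) (by rw [hc]; exact_mod_cast (by linarith))
    filter_upwards [h, eventually_ne_atTop 0] with N h1 hN
    rwa [setLIntegral_empiricalEvent_univ hN] at h1
  constructor
  · intro F hF
    rw [← EReal.le_neg]
    refine le_of_forall_lt fun r hr => ?_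
    obtain ⟨a, hra, ha⟩ := EReal.lt_iff_exists_real_btwn.1 hr
    obtain ⟨a', haa', ha'⟩ := EReal.lt_iff_exists_real_btwn.1 ha
    have haa : a < a' := by exact_mod_cast haa'
    refine hra.trans_le (EReal.le_neg_of_le_neg ?_)
    have hb : ∀ μ ∈ F, ((a' + c : ℝ) : EReal) < energy β V μ := fun μ hμ => by
      have h1 : (a' : EReal) < energy β V μ - energy β V μstar :=
        ha'.trans_le (iInf₂_le μ hμ)
      rw [hc, EReal.lt_sub_iff_add_lt (by simp) (by simp)] at h1
      rwa [EReal.coe_add]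
    -- The margin `a' - a` is shared equally between the integral over the event and `Z_N`, so that
    -- the quotient has rate exactly `a`.
    have hF' := eventually_setLIntegral_density_le_of_isClosed hβ hV hC hZ hF
      (a := (a + a') / 2 + c) (b := a' + c) (by linarith) hb
    rw [← EReal.coe_neg]
    refine limsup_le_of_le (by isBoundedDefault) ?_
    filter_upwards [hF', hZge ((a' - a) / 2) (by linarith), eventually_ne_atTop 0] with N h1 h2 hN
    refine inv_sq_mul_log_le hN ?_
    rw [gasLaw_apply]
    calc _ ≤ (ENNReal.ofReal (Real.exp (-((c + (a' - a) / 2) * (N : ℝ) ^ 2))))⁻¹ *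
          ENNReal.ofReal (Real.exp (-(((a + a') / 2 + c) * (N : ℝ) ^ 2))) := by gcongr
      _ = _ := by
        rw [ofReal_exp_inv, ← ENNReal.ofReal_mul (Real.exp_nonneg _), ← Real.exp_add]
        congr 2
        ring
  · intro O hO
    rw [EReal.neg_le]
    refine le_iInf₂ fun μ hμ => ?_
    refine le_of_forall_gt fun r hr => ?_
    obtain ⟨a, ha, har⟩ := EReal.lt_iff_exists_real_btwn.1 hr
    obtain ⟨a', ha', haa'⟩ := EReal.lt_iff_exists_real_btwn.1 ha
    have haa : a' < a := by exact_mod_cast haa'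
    refine lt_of_le_of_lt (EReal.neg_le_of_neg_le ?_) har
    have hb : energy β V μ < ((a' + c : ℝ) : EReal) := by
      rw [hc, EReal.sub_lt_iff (by simp) (by simp)] at ha'
      rwa [EReal.coe_add]
    have hO' := eventually_le_setLIntegral_density_of_isOpen hβ hV hC hO hμ hb
    rw [← EReal.coe_neg]
    refine le_liminf_of_le (by isBoundedDefault) ?_
    filter_upwards [hO', hZle (a - a') (by linarith), eventually_ne_atTop 0] with N h1 h2 hN
    refine le_inv_sq_mul_log hN ?_
    rw [gasLaw_apply]
    calc _ = (ENNReal.ofReal (Real.exp (-((c - (a - a')) * (N : ℝ) ^ 2))))⁻¹ *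
          ENNReal.ofReal (Real.exp (-((a' + c) * (N : ℝ) ^ 2))) := by
          rw [ofReal_exp_inv, ← ENNReal.ofReal_mul (Real.exp_nonneg _), ← Real.exp_add]
          congr 2
          ring
      _ ≤ _ := by gcongr

end LDP

end CoulombGas

namespace CoulombGas

/-! ### The spherically invariant gas. -/

section Spherical

variable {Δ : Type} [NormedAddCommGroup Δ] {β β' : ℝ}

/-- The potential which is constant relative to the stereographic projection. -/
def sphericalPotential (Δ : Type) [NormedAddCommGroup Δ] (β : ℝ) (x : Δ) : ℝ :=
  β / 2 * Real.log (1 + ‖x‖ ^ 2)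

lemma continuous_sphericalPotential : Continuous (sphericalPotential Δ β) :=
  continuous_const.mul ((by fun_prop : Continuous fun x : Δ => 1 + ‖x‖ ^ 2).log
    fun x => by positivity)

lemma admissible_sphericalPotential (hβ : 1 < β) : Admissible β β (sphericalPotential Δ β) where
  beta_pos := one_pos.trans hβ
  one_lt := hβ
  beta_le := le_rfl
  continuous := continuous_sphericalPotential
  growth := by
    refine lt_of_lt_of_le (EReal.bot_lt_coe 0) (le_liminf_of_le (by isBoundedDefault) ?_)
    filter_upwards [eventually_cobounded_le_norm (1 : ℝ)] with x hx
    have h1 : 2 * Real.log ‖x‖ ≤ Real.log (1 + ‖x‖ ^ 2) := by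
      have h2 : Real.log (‖x‖ ^ 2) = 2 * Real.log ‖x‖ := by
        rw [Real.log_pow]
        norm_num
      rw [← h2]
      exact Real.log_le_log (by positivity) (by linarith)
    have h3 := mul_le_mul_of_nonneg_left h1 (by linarith : 0 ≤ β / 2)
    rw [EReal.coe_le_coe_iff, sphericalPotential]
    linarith

lemma le_sphericalPotential (x : Δ) :
    β / 2 * Real.log (1 + ‖x‖ ^ 2) ≤ sphericalPotential Δ β x + 0 := by
  simp [sphericalPotential]

/-- For this potential the relative potential vanishes, so the kernel is a function of `cosSq`
alone. -/
lemma posKernel_congr_of_cosSq_eq (hβ : 0 < β) {x y x' y' : Δ} (h : cosSq x y = cosSq x' y') :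
    posKernel β (sphericalPotential Δ β) 0 x y = posKernel β (sphericalPotential Δ β) 0 x' y' := by
  have hrel : ∀ z : Δ, relPotential β (sphericalPotential Δ β) 0 z = 0 := fun z => by
    simp [relPotential, sphericalPotential]
  rw [posKernel_eq_tsum hβ le_sphericalPotential, posKernel_eq_tsum hβ le_sphericalPotential]
  simp only [hrel, h]

variable [InnerProductSpace ℝ Δ]

/-- The inversion that corresponds to a reflection of the sphere: it exchanges `x₀` and the point at
infinity, and preserves `cosSq`. -/
def sphericalInversion (x₀ : Δ) : Δ → Δ :=
  EuclideanGeometry.inversion x₀ √(1 + ‖x₀‖ ^ 2)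

/-- The conformal factor of the inversion. The squared radius `1 + ‖x₀‖ ^ 2` is what makes the right
side factor. -/
lemma one_add_norm_sphericalInversion_sq {x₀ x : Δ} (hx : x ≠ x₀) :
    1 + ‖sphericalInversion x₀ x‖ ^ 2 =
      (1 + ‖x₀‖ ^ 2) * (1 + ‖x‖ ^ 2) / ‖x - x₀‖ ^ 2 := by
  have hd : 0 < ‖x - x₀‖ := norm_pos_iff.2 (sub_ne_zero.2 hx)
  have h1 : ‖x‖ ^ 2 = ‖x - x₀‖ ^ 2 + 2 * inner ℝ (x - x₀) x₀ + ‖x₀‖ ^ 2 := by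
    rw [← norm_add_sq_real, sub_add_cancel]
  rw [sphericalInversion, EuclideanGeometry.inversion, vsub_eq_sub, vadd_eq_add, norm_add_sq_real,
    norm_smul, inner_smul_left, dist_eq_norm, div_pow, Real.sq_sqrt (by positivity), h1,
    Real.norm_of_nonneg (by positivity)]
  simp only [conj_trivial]
  field_simp
  ring

/-- The factors by which the inversion changes the squared distance and the two conformal factors
cancel. -/
lemma cosSq_sphericalInversion {x₀ x y : Δ} (hx : x ≠ x₀) (hy : y ≠ x₀) :
    cosSq (sphericalInversion x₀ x) (sphericalInversion x₀ y) = cosSq x y := by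
  have hd : 0 < ‖x - x₀‖ := norm_pos_iff.2 (sub_ne_zero.2 hx)
  have hd' : 0 < ‖y - x₀‖ := norm_pos_iff.2 (sub_ne_zero.2 hy)
  have h := EuclideanGeometry.dist_inversion_inversion hx hy √(1 + ‖x₀‖ ^ 2)
  rw [dist_eq_norm, dist_eq_norm, dist_eq_norm, dist_eq_norm, Real.sq_sqrt (by positivity),
    ← sphericalInversion] at h
  rw [cosSq, cosSq, one_add_norm_sphericalInversion_sq hx, one_add_norm_sphericalInversion_sq hy, h]
  field_simp

variable [MeasurableSpace Δ] [BorelSpace Δ] [SecondCountableTopology Δ]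

lemma measurable_sphericalInversion (x₀ : Δ) : Measurable (sphericalInversion x₀) := by
  have : sphericalInversion x₀ =
      fun x => (√(1 + ‖x₀‖ ^ 2) / dist x x₀) ^ 2 • (x - x₀) + x₀ := rfl
  rw [this]
  fun_prop

omit [InnerProductSpace ℝ Δ] in
-- An atom would charge the diagonal of the product, where the kernel is infinite.
lemma measure_singleton_eq_zero_of_mutualEnergy_ne_top {V : Δ → ℝ} {C : ℝ} (hβ : 0 < β)
    {μ : Measure Δ} (hμ : mutualEnergy β V C μ μ ≠ ⊤) (x : Δ) : μ {x} = 0 := by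
  by_contra h
  refine hμ (top_unique ?_)
  calc (⊤ : ℝ≥0∞) = ∫⁻ y in {x}, ∫⁻ z in {x}, posKernel β V C y z ∂μ ∂μ := by
        simp [posKernel_self hβ, h]
    _ ≤ ∫⁻ y in {x}, ∫⁻ z, posKernel β V C y z ∂μ ∂μ :=
        lintegral_mono fun y => setLIntegral_le_lintegral _ _
    _ ≤ _ := setLIntegral_le_lintegral _ _

/-- The centre must be negligible: there the inversion returns the centre instead of the point at
infinity. -/
lemma mutualEnergy_map_sphericalInversion (hβ : 0 < β) {μ : Measure Δ} [SFinite μ] {x₀ : Δ}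
    (h0 : μ {x₀} = 0) :
    mutualEnergy β (sphericalPotential Δ β) 0 (μ.map (sphericalInversion x₀))
      (μ.map (sphericalInversion x₀)) = mutualEnergy β (sphericalPotential Δ β) 0 μ μ := by
  have hm := measurable_sphericalInversion x₀
  have hpk := measurable_posKernel (β := β) (C := 0) (continuous_sphericalPotential (Δ := Δ) (β := β))
  have h1 : Measurable fun x => ∫⁻ y, posKernel β (sphericalPotential Δ β) 0 x y
      ∂(μ.map (sphericalInversion x₀)) := hpk.lintegral_prod_right'
  have h2 : ∀ x, Measurable fun y => posKernel β (sphericalPotential Δ β) 0 x y := fun x =>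
    hpk.comp measurable_prodMk_left
  have hae : ∀ᵐ x ∂μ, x ≠ x₀ := by rwa [ae_iff, show {a | ¬a ≠ x₀} = {x₀} by ext; simp]
  rw [mutualEnergy, lintegral_map h1 hm, mutualEnergy]
  refine lintegral_congr_ae ?_
  filter_upwards [hae] with x hx
  rw [lintegral_map (h2 _) hm]
  refine lintegral_congr_ae ?_
  filter_upwards [hae] with y hy
  exact posKernel_congr_of_cosSq_eq hβ (cosSq_sphericalInversion hx hy)

end Spherical

/-! ### A minimizer without compact support. -/

section Support

variable {Δ : Type} [NormedAddCommGroup Δ] [InnerProductSpace ℝ Δ] [FiniteDimensional ℝ Δ]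
  [MeasurableSpace Δ] [BorelSpace Δ] [Nontrivial Δ]

/-- The equilibrium measure of the spherical potential does not have compact support. -/
lemma exists_isMinimizer_not_isCompact_support {β : ℝ} (hβ : 0 < β) :
    ∃ μ : ProbabilityMeasure Δ, IsMinimizer β (sphericalPotential Δ β) μ ∧
      ¬ IsCompact (μ : Measure Δ).support := by
  have hV := continuous_sphericalPotential (Δ := Δ) (β := β)
  obtain ⟨μ, hmin, huniq, hfin⟩ := exists_isMinimizer hβ hV le_sphericalPotential
  refine ⟨μ, hmin, fun hK => ?_⟩
  obtain ⟨x₀, hx₀⟩ := Measure.nonempty_support (μ := (μ : Measure Δ)) (NeZero.ne _)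
  have h0 := measure_singleton_eq_zero_of_mutualEnergy_ne_top hβ hfin x₀
  have hm := measurable_sphericalInversion x₀
  -- The image of the minimizer has the same energy, so uniqueness makes the minimizer invariant.
  have hmap : (μ : Measure Δ).map (sphericalInversion x₀) = μ := by
    let ν : ProbabilityMeasure Δ := ⟨(μ : Measure Δ).map (sphericalInversion x₀),
      Measure.isProbabilityMeasure_map hm.aemeasurable⟩
    have hν : IsMinimizer β (sphericalPotential Δ β) ν := fun ρ => by
      refine le_trans ?_ (hmin ρ)
      rw [energy_le_energy_iff hβ hV le_sphericalPotential]
      exact (mutualEnergy_map_sphericalInversion hβ h0).le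
    exact congrArg ProbabilityMeasure.toMeasure (huniq ν hν)
  -- Points near `x₀` are sent near infinity, hence outside a compact support. By invariance a
  -- punctured neighbourhood of `x₀` would be null, although `x₀` lies in the support.
  have hU : insert x₀ (sphericalInversion x₀ ⁻¹' (μ : Measure Δ).supportᶜ) ∈ 𝓝 x₀ := by
    have h1 := EuclideanGeometry.tendsto_inversion_nhdsNE_center_cobounded (c := x₀)
      (R := √(1 + ‖x₀‖ ^ 2)) (by positivity)
    have h2 : ∀ᶠ x in 𝓝[≠] x₀, sphericalInversion x₀ x ∈ (μ : Measure Δ).supportᶜ :=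
      h1.eventually (Bornology.isBounded_def.1 hK.isBounded)
    exact insert_mem_nhds_iff.2 h2
  have hpos := (Measure.mem_support_iff_forall x₀).1 hx₀ _ hU
  refine hpos.ne' (measure_mono_null (Set.insert_eq _ _).subset (measure_union_null h0 ?_))
  rw [← Measure.map_apply hm Measure.isOpen_compl_support.measurableSet, hmap]
  exact Measure.measure_compl_support

end Support

end CoulombGas

namespace CoulombGas

/-! ### Consequences of admissibility, and the theorem. -/

variable {Δ : Type} [NormedAddCommGroup Δ] [InnerProductSpace ℝ Δ] [FiniteDimensional ℝ Δ]
  [MeasureSpace Δ] [BorelSpace Δ] [(volume : Measure Δ).IsAddHaarMeasure] {β β' : ℝ} {V : Δ → ℝ}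

omit [MeasureSpace Δ] [BorelSpace Δ] [(volume : Measure Δ).IsAddHaarMeasure] in
lemma Admissible.exists_le_kernel (h : Admissible β β' V) :
    ∃ C : ℝ, ∀ x y : Δ, (C : EReal) ≤ kernel β V x y := by
  obtain ⟨C, hC⟩ := h.exists_growth
  exact ⟨-C, neg_le_kernel h.beta_pos (growth_of_le h.beta_le hC)⟩

omit [(volume : Measure Δ).IsAddHaarMeasure] in
lemma Admissible.isCompact_setOf_energy_le (h : Admissible β β' V) (α : ℝ) :
    IsCompact {μ : ProbabilityMeasure Δ | energy β V μ ≤ (α : EReal)} := by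
  obtain ⟨C, hC⟩ := h.exists_growth
  exact CoulombGas.isCompact_setOf_energy_le h.beta_pos h.continuous (growth_of_le h.beta_le hC) α

/-- The decay exponent `N * β' - (N - 1) * β` equals `β' + (N - 1) * (β' - β)`, so it is at least
`β'` for `N ≥ 1`. -/
lemma Admissible.partitionFunction_lt_top (h : Admissible β β' V)
    (hd : (Module.finrank ℝ Δ : ℝ) < β') (N : ℕ) : partitionFunction β V N < ⊤ := by
  obtain ⟨C, hC⟩ := h.exists_growth
  refine CoulombGas.partitionFunction_lt_top h.beta_pos hC N fun hN => ?_
  have hN1 : (1 : ℝ) ≤ N := by exact_mod_cast Nat.one_le_iff_ne_zero.2 hN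
  nlinarith [mul_nonneg (sub_nonneg.2 hN1) (sub_nonneg.2 h.beta_le)]

lemma Admissible.eventually_partitionFunction_lt_top (h : Admissible β β' V) (hlt : β < β') :
    ∀ᶠ N in atTop, partitionFunction β V N < ⊤ := by
  obtain ⟨C, hC⟩ := h.exists_growth
  have ht : Tendsto (fun N : ℕ => (N : ℝ) * (β' - β)) atTop atTop :=
    tendsto_natCast_atTop_atTop.atTop_mul_const (sub_pos.2 hlt)
  filter_upwards [ht.eventually_gt_atTop (Module.finrank ℝ Δ : ℝ)] with N hN
  refine CoulombGas.partitionFunction_lt_top h.beta_pos hC N fun _ => ?_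
  linarith [h.beta_pos]

lemma Admissible.exists_isMinimizer_empiricalLDP [Nontrivial Δ] (h : Admissible β β' V) :
    ∃ μstar : ProbabilityMeasure Δ, IsMinimizer β V μstar ∧
      (∀ μ : ProbabilityMeasure Δ, IsMinimizer β V μ → μ = μstar) ∧
      (∃ c : ℝ, energy β V μstar = (c : EReal)) ∧
      ((∀ᶠ N : ℕ in atTop, partitionFunction β V N < ⊤) →
        EmpiricalLDP (gasLaw β V) (fun μ => energy β V μ - energy β V μstar)) := by
  obtain ⟨C, hC'⟩ := h.exists_growth
  have hC := growth_of_le h.beta_le hC'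
  obtain ⟨μ, hmin, huniq, hfin⟩ := exists_isMinimizer h.beta_pos h.continuous hC
  obtain ⟨c, hc⟩ := exists_energy_eq_coe h.beta_pos h.continuous hC hfin
  exact ⟨μ, hmin, huniq, ⟨c, hc⟩, fun hZ =>
    empiricalLDP_gasLaw h.beta_pos h.continuous hC hZ hmin hc⟩

end CoulombGas

end

theorem theorem1 :
    -- the real line
    (∀ (β β' : ℝ) (V : ℝ → ℝ), CoulombGas.Admissible β β' V →
      (∃ C : ℝ, ∀ x y : ℝ, (C : EReal) ≤ CoulombGas.kernel β V x y) ∧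
      (∀ N : ℕ, CoulombGas.partitionFunction β V N < ⊤) ∧
      (∀ α : ℝ, IsCompact {μ : ProbabilityMeasure ℝ | CoulombGas.energy β V μ ≤ (α : EReal)}) ∧
      ∃ μstar : ProbabilityMeasure ℝ,
        CoulombGas.IsMinimizer β V μstar ∧
        (∀ μ : ProbabilityMeasure ℝ, CoulombGas.IsMinimizer β V μ → μ = μstar) ∧
        (∃ c : ℝ, CoulombGas.energy β V μstar = (c : EReal)) ∧
        CoulombGas.EmpiricalLDP (CoulombGas.gasLaw β V)
          (fun μ => CoulombGas.energy β V μ - CoulombGas.energy β V μstar)) ∧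
    -- the complex plane
    (∀ (β β' : ℝ) (V : ℂ → ℝ), CoulombGas.Admissible β β' V →
      (∃ C : ℝ, ∀ x y : ℂ, (C : EReal) ≤ CoulombGas.kernel β V x y) ∧
      (2 < β' → ∀ N : ℕ, CoulombGas.partitionFunction β V N < ⊤) ∧
      (β < β' → ∀ᶠ N : ℕ in atTop, CoulombGas.partitionFunction β V N < ⊤) ∧
      (∀ α : ℝ, IsCompact {μ : ProbabilityMeasure ℂ | CoulombGas.energy β V μ ≤ (α : EReal)}) ∧
      ∃ μstar : ProbabilityMeasure ℂ,
        CoulombGas.IsMinimizer β V μstar ∧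
        (∀ μ : ProbabilityMeasure ℂ, CoulombGas.IsMinimizer β V μ → μ = μstar) ∧
        (∃ c : ℝ, CoulombGas.energy β V μstar = (c : EReal)) ∧
        ((∀ᶠ N : ℕ in atTop, CoulombGas.partitionFunction β V N < ⊤) →
          CoulombGas.EmpiricalLDP (CoulombGas.gasLaw β V)
            (fun μ => CoulombGas.energy β V μ - CoulombGas.energy β V μstar))) ∧
    -- in both cases the minimizer may have non-compact support
    (∃ (β β' : ℝ) (V : ℝ → ℝ) (μ : ProbabilityMeasure ℝ), CoulombGas.Admissible β β' V ∧
      CoulombGas.IsMinimizer β V μ ∧ ¬ IsCompact (μ : Measure ℝ).support) ∧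
    (∃ (β β' : ℝ) (V : ℂ → ℝ) (μ : ProbabilityMeasure ℂ), CoulombGas.Admissible β β' V ∧
      (∀ N : ℕ, CoulombGas.partitionFunction β V N < ⊤) ∧
      CoulombGas.IsMinimizer β V μ ∧ ¬ IsCompact (μ : Measure ℂ).support) := by
  refine ⟨fun β β' V h => ?_, fun β β' V h => ?_, ?_, ?_⟩
  · have hZ := h.partitionFunction_lt_top (by simpa using h.one_lt)
    obtain ⟨μ, hmin, huniq, hfin, hldp⟩ := h.exists_isMinimizer_empiricalLDP
    exact ⟨h.exists_le_kernel, hZ, h.isCompact_setOf_energy_le, μ, hmin, huniq, hfin,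
      hldp (Eventually.of_forall hZ)⟩
  · exact ⟨h.exists_le_kernel, fun h2 => h.partitionFunction_lt_top (by simpa using h2),
      h.eventually_partitionFunction_lt_top, h.isCompact_setOf_energy_le,
      h.exists_isMinimizer_empiricalLDP⟩
  · obtain ⟨μ, hmin, hμ⟩ :=
      CoulombGas.exists_isMinimizer_not_isCompact_support (Δ := ℝ) (β := 2) (by norm_num)
    exact ⟨2, 2, _, μ, CoulombGas.admissible_sphericalPotential (by norm_num), hmin, hμ⟩
  -- In the plane `β = 3` exceeds the real dimension 2, which makes every `Z_N` finite although `β'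
  -- = β`.
  · obtain ⟨μ, hmin, hμ⟩ :=
      CoulombGas.exists_isMinimizer_not_isCompact_support (Δ := ℂ) (β := 3) (by norm_num)
    have h := CoulombGas.admissible_sphericalPotential (Δ := ℂ) (β := 3) (by norm_num)
    exact ⟨3, 3, _, μ, h, h.partitionFunction_lt_top (by norm_num), hmin, hμ⟩
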